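/- Let $S^2$ be the unit sphere in $\mathbb R^3$ with its round metric $h_{AB}$, area form $\epsilon_{AB}$, Levi-Civita derivative (written $D_A$ or $_{||A}$, so that $f_{||AB}=D_BD_Af$) and Laplacian $D^2$; indices are raised and lowered with $h$ and all integrals over $S^2$ are with respect to the standard area measure. Let $\chi_{AB}$ be a smooth symmetric traceless tensor field (the shear tensor), $N_A$ a smooth one-form (the angular aspect) and $m$ a smooth function (the mass aspect) on $S^2$, let $n$ be a linear combination of the $l=1$ spherical harmonics, and let $\alpha\in\mathbb R$. Define \begin{align*} J^{(\mathrm{CJK})} &= -\frac1{8\pi}\int_{S^2}\Bigl(3N_A+\tfrac14\chi_{AB}\chi^{BC}{}_{||C}\Bigr)\epsilon^{AD}n_{||D},\\ J^{(\mathrm{CN})} &= J^{(\mathrm{CJK})}-\frac{\alpha-1}{32\pi}\int_{S^2}\epsilon^{AD}n_{||D}\,\chi_{AB}\chi^{BC}{}_{||C},\\ J^{(\mathrm{CWY})} &= J^{(\mathrm{CJK})}+\frac1{4\pi}\int_{S^2}m\,\epsilon^{AB}n_{||B}\,\hat c_{||A}, \end{align*} where $\hat c$ is the smooth function without $l=0,1$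 parts that satisfies $D^2(D^2+2)\hat c=\chi_{AB}{}^{||BA}$. Then: 1. There are smooth functions $b,c:S^2\to\mathbb R$, both without $l=0,1$ parts, such that $$\chi_{AB}=2c_{||AB}-h_{AB}D^2c+\epsilon_{AC}\,b^{||C}{}_{||B}+\epsilon_{BC}\,b^{||C}{}_{||A}.\qquad(*)$$ 2. The function $\hat c$ exists and is unique. 3. Let $b,c$ be any smooth functions on $S^2$ that satisfy $(*)$. The parts of $\int_{S^2}\chi_{AB}\chi^{BC}{}_{||C}\,\epsilon^{AD}n_{||D}$ that are quadratic in $b$ alone and in $c$ alone (its values when $\chi$ is replaced by the right-hand side of $(*)$ with $c=0$, respectively with $b=0$) vanish, and \begin{align*} J^{(\mathrm{CJK})} &= \frac1{8\pi}\int_{S^2}\Bigl(-3N_A\epsilon^{AD}n_{||D}-2n_{||A}c^{||A}D^2b+\tfrac12 n\,D^2b\,D^2c-\tfrac12 n_{||A}\,D^2b\,(D^2c)^{||A}\Bigr),\\ J^{(\mathrm{CN})} &= \frac1{8\pi}\int_{S^2}\Bigl(-3N_A\epsilon^{AD}n_{||D}-2\alpha\, n_{||A}c^{||A}D^2b+\tfrac\alpha2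 n\,D^2b\,D^2c-\tfrac\alpha2 n_{||A}\,D^2b\,(D^2c)^{||A}\Bigr). \end{align*} If moreover $c$ has no $l=0,1$ parts, then $c=\hat c$ and $$J^{(\mathrm{CWY})} = \frac1{8\pi}\int_{S^2}\Bigl(-3N_A\epsilon^{AD}n_{||D}-2n_{||A}c^{||A}D^2b+\tfrac12 n\,D^2b\,D^2c-\tfrac12 n_{||A}\,D^2b\,(D^2c)^{||A}+2m\,\epsilon^{AD}n_{||D}c_{||A}\Bigr).$$ -/

import Mathlib

open MeasureTheory
open scoped Manifold ContDiff

noncomputable section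

namespace NullInfinity

/-! ### Tensor calculus on the round unit sphere

The sphere is the unit sphere of Euclidean `ℝ³`.  A covariant tensor at `p` on the tangent plane
`T_p = p^⊥` is identified with the tensor on `ℝ³` that vanishes as soon as one argument is normal,
and is given by its Cartesian components.  For such tangential tensors, raising an index with the
round metric does not change the components, and contraction with the round metric is the sum over
the Cartesian index. -/

/-- Euclidean three-space. -/
abbrev E3 : Type := EuclideanSpace ℝ (Fin 3)

/-- The unit sphere `S²`. -/
abbrev S2 : Type := Metric.sphere (0 : E3) 1

/-- The standard area measure of `S²` (total mass `4π`). -/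
def area : Measure S2 := (volume : Measure E3).toSphere

/-- Smooth real functions on `S²`. -/
def Smooth (f : S2 → ℝ) : Prop := ContMDiff (𝓡 2) 𝓘(ℝ, ℝ) ∞ f

/-- Extension of a function on `S²` to `ℝ³ ∖ {0}`, constant along rays. -/
def radialExt (f : S2 → ℝ) (x : E3) : ℝ :=
  if hx : x = 0 then 0 else f ⟨‖x‖⁻¹ • x, by
    rw [mem_sphere_zero_iff_norm, norm_smul, norm_inv, norm_norm,
      inv_mul_cancel₀ (norm_ne_zero_iff.mpr hx)]⟩

/-- The derivative of `f` at `p` in the direction of the tangential part of the `k`-th Cartesian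
unit vector.  (The radial extension has no radial derivative, so the projection is automatic.) -/
def tder (k : Fin 3) (f : S2 → ℝ) (p : S2) : ℝ :=
  fderiv ℝ (radialExt f) (p : E3) (EuclideanSpace.single k (1 : ℝ))

/-- The round metric `h_{AB}`, which is also the orthogonal projection onto the tangent plane. -/
def metric (p : S2) (i j : Fin 3) : ℝ :=
  (if i = j then 1 else 0) - (p : E3) i * (p : E3) j

/-- The area form `ε_{AB}`: `ε(X, Y) = det (p, X, Y)`, with the outward orientation. -/
def eps (p : S2) (i j : Fin 3) : ℝ :=
  Matrix.det (Matrix.of ![fun k => (p : E3) k, Pi.single i (1 : ℝ), Pi.single j (1 : ℝ)])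

/-- `f_{||A}`. -/
def grad (f : S2 → ℝ) (p : S2) (i : Fin 3) : ℝ := tder i f p

/-- `w_{A||B}`: Levi-Civita covariant derivative of a one-form, i.e. the tangential projection of
the tangential derivative.  The last index is the one of the derivative. -/
def covD1 (w : S2 → Fin 3 → ℝ) (p : S2) (i k : Fin 3) : ℝ :=
  ∑ a, metric p i a * tder k (fun q => w q a) p

/-- `T_{AB||C}`: Levi-Civita covariant derivative of a covariant tensor field of rank two.
The last index is the one of the derivative. -/
def covD2 (T : S2 → Fin 3 → Fin 3 → ℝ) (p : S2) (i j k : Fin 3) : ℝ :=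
  ∑ a, ∑ b, metric p i a * metric p j b * tder k (fun q => T q a b) p

/-- `f_{||AB}`. -/
def hess (f : S2 → ℝ) (p : S2) (i j : Fin 3) : ℝ := covD1 (grad f) p i j

/-- The Laplacian `D²f = f_{||A}^{||A}`. -/
def lap (f : S2 → ℝ) (p : S2) : ℝ := ∑ i, hess f p i i

/-- `w_A^{||A}`. -/
def div1 (w : S2 → Fin 3 → ℝ) (p : S2) : ℝ := ∑ i, covD1 w p i i

/-- `T_{AB}^{||B}`. -/
def div2 (T : S2 → Fin 3 → Fin 3 → ℝ) (p : S2) (i : Fin 3) : ℝ := ∑ j, covD2 T p i j j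

/-- `f_{||A} g^{||A}`. -/
def gradDot (f g : S2 → ℝ) (p : S2) : ℝ := ∑ i, grad f p i * grad g p i

/-- The vector field `ε^{AD} n_{||D}`. -/
def rot (n : S2 → ℝ) (p : S2) (i : Fin 3) : ℝ := ∑ d, eps p i d * grad n p d

/-- Smooth one-forms on `S²`. -/
structure IsOneForm (w : S2 → Fin 3 → ℝ) : Prop where
  smooth : ∀ i, Smooth fun p => w p i
  tangential : ∀ p, ∑ i, w p i * (p : E3) i = 0

/-- Smooth symmetric traceless covariant tensor fields of rank two on `S²`. -/
structure IsSymmTraceless (T : S2 → Fin 3 → Fin 3 → ℝ) : Prop where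
  smooth : ∀ i j, Smooth fun p => T p i j
  tangential : ∀ p i, ∑ j, T p i j * (p : E3) j = 0
  symm : ∀ p i j, T p i j = T p j i
  traceless : ∀ p, ∑ i, T p i i = 0

/-- Linear combinations of the `l = 1` spherical harmonics: restrictions of linear forms. -/
def IsDipole (n : S2 → ℝ) : Prop := ∃ a : E3, ∀ p : S2, n p = inner ℝ a (p : E3)

/-- `f` has no `l = 0` and no `l = 1` part: it is `L²`-orthogonal to the constants and to the
Cartesian coordinate functions, which span the `l = 1` spherical harmonics. -/
def NoLowModes (f : S2 → ℝ) : Prop :=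
  ∫ p, f p ∂area = 0 ∧ ∀ i : Fin 3, ∫ p, f p * (p : E3) i ∂area = 0

/-! ### Potentials and angular momenta -/

/-- `2 c_{||AB} - h_{AB} D²c + ε_{AC} b^{||C}_{||B} + ε_{BC} b^{||C}_{||A}`. -/
def shearOf (b c : S2 → ℝ) (p : S2) (i j : Fin 3) : ℝ :=
  2 * hess c p i j - metric p i j * lap c p
    + ∑ k, eps p i k * hess b p k j + ∑ k, eps p j k * hess b p k i

/-- `χ_{AB} χ^{BC}_{||C}`. -/
def quad (χ : S2 → Fin 3 → Fin 3 → ℝ) (p : S2) (i : Fin 3) : ℝ :=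
  ∑ j, χ p i j * div2 χ p j

/-- The Chruściel–Jezierski–Kijowski angular momentum. -/
def JCJK (N : S2 → Fin 3 → ℝ) (χ : S2 → Fin 3 → Fin 3 → ℝ) (n : S2 → ℝ) : ℝ :=
  -(1 / (8 * Real.pi)) *
    ∫ p, ∑ i, (3 * N p i + 1 / 4 * quad χ p i) * rot n p i ∂area

/-- The Compère–Nichols angular momentum with parameter `α`. -/
def JCN (α : ℝ) (N : S2 → Fin 3 → ℝ) (χ : S2 → Fin 3 → Fin 3 → ℝ) (n : S2 → ℝ) : ℝ :=
  JCJK N χ n - (α - 1) / (32 * Real.pi) * ∫ p, ∑ i, rot n p i * quad χ p i ∂area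

/-- `c` is a smooth solution of `D²(D² + 2)c = χ_{AB}^{||BA}` without `l = 0, 1` parts. -/
structure IsCWYPotential (χ : S2 → Fin 3 → Fin 3 → ℝ) (c : S2 → ℝ) : Prop where
  smooth : Smooth c
  noLow : NoLowModes c
  eqn : ∀ p, lap (fun q => lap c q + 2 * c q) p = div1 (div2 χ) p

/-- The solution of `D²(D² + 2)c = χ_{AB}^{||BA}` without `l = 0, 1` parts. -/
def cwyPotential (χ : S2 → Fin 3 → Fin 3 → ℝ) : S2 → ℝ :=
  Classical.epsilon (IsCWYPotential χ)

/-- The Chen–Wang–Yau angular momentum. -/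
def JCWY (m : S2 → ℝ) (N : S2 → Fin 3 → ℝ) (χ : S2 → Fin 3 → Fin 3 → ℝ) (n : S2 → ℝ) : ℝ :=
  JCJK N χ n
    + 1 / (4 * Real.pi) * ∫ p, m p * ∑ i, rot n p i * grad (cwyPotential χ) p i ∂area

end NullInfinity

end

noncomputable section

namespace NullInfinity

/-! ### Smooth functions and tangential derivatives -/

/-! Put C = (D² + 2)c and B = (D² + 2)b. The Ricci tensor of the sphere is h and rotation by a right
angle, written ⋆, is parallel, so the right-hand side of (*) has divergence ∇C + ⋆∇B
(`divT_shearPair`). Its double divergence is D²C, and the curl of its divergence is -D²B. These two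
scalars determine a symmetric traceless tensor (`eq_of_div_eq`), because the sphere carries neither
harmonic one-forms nor divergence free symmetric traceless tensors. Parts 1 and 2 thus reduce to
solving D²(D² + 2)u = g uniquely without l = 0, 1 parts. The sources g that occur have no such
parts, since they are double divergences and the functions with l = 0, 1 have pure trace Hessian.

The scalar equation is solved by convolution with (1 - z) log (1 - z), where z is the inner product
of the two points. For κ > 1 and w = κ - ⟨q, ·⟩ the operator sends w log w to 2(κ² - 1)²/w³ plus l =
0, 1 terms. The first term concentrates at q as κ → 1, which gives the representation formula
`integral_kernel_mul_bilap`. Uniqueness is immediate from it, and existence follows by duality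
(`bilap_greenConv`). No elliptic regularity is needed: convolution of a smooth function with a
continuous zonal kernel is smooth, because a reflection moves the dependence on the point from the
kernel to the function (`smooth_zonal_convolution`).

For part 3, ξ = ⋆∇n is a Killing field. Integrating by parts against it turns the quadratic integral
into ∫ B ∇n·∇C - ∫ C ∇n·∇B (`integral_quadRot_eq_gdot`), so nothing quadratic in b or in c alone
survives. The stated densities then follow from D²n = -2n and nC - ∇n·∇C = -D²(nc + ∇n·∇c)
(`integral_quadRot`).

All tensor identities are reduced to Cartesian components. They follow from the few relations
collected in `SphereCalculus`, so that their verification is commutative algebra. -/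

lemma radialExt_coe (f : S2 → ℝ) (p : S2) : radialExt f (p : E3) = f p := by
  have hp : (p : E3) ≠ 0 := ne_zero_of_mem_unit_sphere p
  have hn : ‖(p : E3)‖ = 1 := norm_eq_of_mem_sphere p
  rw [radialExt, dif_neg hp]
  congr 1
  ext1
  simp [hn]

lemma radialExt_smul (f : S2 → ℝ) {r : ℝ} (hr : 0 < r) (x : E3) :
    radialExt f (r • x) = radialExt f x := by
  by_cases hx : x = 0
  · simp [hx]
  · have hrx : r • x ≠ 0 := smul_ne_zero hr.ne' hx
    rw [radialExt, radialExt, dif_neg hrx, dif_neg hx]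
    congr 2
    rw [norm_smul, Real.norm_of_nonneg hr.le, smul_smul]
    congr 1
    field_simp

/-- The radial projection of a nonzero vector to the sphere. -/
def toS2 (x : E3) (hx : x ≠ 0) : S2 := ⟨‖x‖⁻¹ • x, by
    rw [mem_sphere_zero_iff_norm, norm_smul, norm_inv, norm_norm,
      inv_mul_cancel₀ (norm_ne_zero_iff.mpr hx)]⟩

lemma radialExt_of_ne (f : S2 → ℝ) {x : E3} (hx : x ≠ 0) : radialExt f x = f (toS2 x hx) :=
  dif_neg hx

lemma contDiffOn_radialExt {f : S2 → ℝ} (hf : Smooth f) :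
    ContDiffOn ℝ ∞ (radialExt f) {0}ᶜ := by
  let U : TopologicalSpace.Opens E3 := ⟨{0}ᶜ, isOpen_compl_singleton⟩
  have hg : ContMDiff 𝓘(ℝ, E3) 𝓘(ℝ, E3) ∞ (fun x : U => ‖(x : E3)‖⁻¹ • (x : E3)) := by
    intro x
    have hx : (x : E3) ≠ 0 := x.2
    have : ContMDiffAt 𝓘(ℝ, E3) 𝓘(ℝ, E3) ∞ (fun y : E3 => ‖y‖⁻¹ • y) (x : E3) := by
      apply ContDiffAt.contMDiffAt
      exact ((contDiffAt_norm ℝ hx).inv (norm_ne_zero_iff.2 hx)).smul contDiffAt_id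
    exact contMDiffAt_subtype_iff.2 this
  have hs : ∀ x : U, ‖(x : E3)‖⁻¹ • (x : E3) ∈ Metric.sphere (0 : E3) 1 := fun x =>
    (toS2 x x.2).2
  have : Fact (Module.finrank ℝ E3 = 2 + 1) := ⟨by simp⟩
  have h1 := ContMDiff.comp (g := f) hf (hg.codRestrict_sphere (n := 2) hs)
  intro x hx
  apply ContDiffAt.contDiffWithinAt
  rw [← contMDiffAt_iff_contDiffAt]
  have h2 := h1 (⟨x, hx⟩ : U)
  refine (contMDiffAt_subtype_iff (U := U) (f := radialExt f) (x := ⟨x, hx⟩)).1 ?_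
  refine h2.congr_of_eventuallyEq (Filter.Eventually.of_forall ?_)
  intro y
  exact radialExt_of_ne f y.2

lemma contDiffAt_radialExt {f : S2 → ℝ} (hf : Smooth f) {x : E3} (hx : x ≠ 0) :
    ContDiffAt ℝ ∞ (radialExt f) x :=
  (contDiffOn_radialExt hf).contDiffAt (isOpen_compl_singleton.mem_nhds hx)

/-- The inclusion of the sphere is smooth, so smoothness can be tested on local extensions to the
ambient space; the extension may depend on the point. -/
lemma Smooth.of_locally {f : S2 → ℝ} (h : ∀ p : S2, ∃ F : E3 → ℝ, ContDiffAt ℝ ∞ F (p : E3) ∧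
    ∀ᶠ q in nhds p, f q = F (q : E3)) : Smooth f := by
  have : Fact (Module.finrank ℝ E3 = 2 + 1) := ⟨by simp⟩
  intro p
  obtain ⟨F, hF, hfF⟩ := h p
  exact (hF.contMDiffAt.comp p (contMDiff_coe_sphere (n := 2) p)).congr_of_eventuallyEq hfF

lemma Smooth.of_contDiffAt {f : S2 → ℝ} (F : E3 → ℝ) (hF : ∀ p : S2, ContDiffAt ℝ ∞ F (p : E3))
    (h : ∀ p : S2, f p = F p) : Smooth f :=
  Smooth.of_locally fun p => ⟨F, hF p, Filter.Eventually.of_forall h⟩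

lemma Smooth.continuous {f : S2 → ℝ} (hf : Smooth f) : Continuous f := ContMDiff.continuous hf

lemma differentiableAt_radialExt {f : S2 → ℝ} (hf : Smooth f) {x : E3} (hx : x ≠ 0) :
    DifferentiableAt ℝ (radialExt f) x :=
  (contDiffAt_radialExt hf hx).differentiableAt (by simp)

lemma coe_ne_zero (p : S2) : (p : E3) ≠ 0 := ne_zero_of_mem_unit_sphere p

lemma tder_eq_of_eventuallyEq {f : S2 → ℝ} {F : E3 → ℝ} {p : S2}
    (h : radialExt f =ᶠ[nhds (p : E3)] F) (k : Fin 3) :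
    tder k f p = fderiv ℝ F p (EuclideanSpace.single k 1) := by
  rw [tder, h.fderiv_eq]

lemma Smooth.tder {f : S2 → ℝ} (hf : Smooth f) (k : Fin 3) : Smooth (tder k f) := by
  refine Smooth.of_contDiffAt (fun x => fderiv ℝ (radialExt f) x (EuclideanSpace.single k 1))
    (fun p => ?_) (fun p => rfl)
  exact ((contDiffAt_radialExt hf (coe_ne_zero p)).fderiv_right (by simp)).clm_apply
    contDiffAt_const

/-- Partial derivatives of a function homogeneous of degree 0 have degree -1; the factor `‖x‖`
restores degree 0. Its own derivative is the source of the commutator in `tder_comm`. -/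
lemma radialExt_tder (f : S2 → ℝ) (k : Fin 3) {x : E3} (hx : x ≠ 0) :
    radialExt (tder k f) x
      = ‖x‖ * fderiv ℝ (radialExt f) x (EuclideanSpace.single k 1) := by
  rw [radialExt_of_ne _ hx, tder]
  have hn : 0 < ‖x‖ := norm_pos_iff.2 hx
  have key : radialExt f = fun y => radialExt f (‖x‖⁻¹ • y) := by
    funext y; rw [radialExt_smul f (inv_pos.2 hn)]
  have h2 : fderiv ℝ (radialExt f) x = ‖x‖⁻¹ • fderiv ℝ (radialExt f) (‖x‖⁻¹ • x) := by
    conv_lhs => rw [key]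
    rw [fderiv_comp_smul]
  rw [h2]
  simp only [toS2, smul_apply, smul_eq_mul]
  field_simp

lemma hasFDerivAt_norm_coe (p : S2) :
    HasFDerivAt (fun x : E3 => ‖x‖) (innerSL ℝ (p : E3)) (p : E3) := by
  have hn : ‖(p : E3)‖ = 1 := norm_eq_of_mem_sphere p
  have := (hasStrictFDerivAt_norm_sq (p : E3)).hasFDerivAt.sqrt (by simp [hn])
  simp only [hn, Real.sqrt_sq (norm_nonneg _)] at this
  convert! this using 1
  ext v
  simp

lemma tder_const (k : Fin 3) (c : ℝ) (p : S2) : tder k (fun _ => c) p = 0 := by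
  have h : radialExt (fun _ => c) =ᶠ[nhds (p : E3)] fun _ => c := by
    filter_upwards [isOpen_compl_singleton.mem_nhds (coe_ne_zero p)] with x hx
    exact radialExt_of_ne _ hx
  rw [tder_eq_of_eventuallyEq h]
  simp

lemma radialExt_add (f g : S2 → ℝ) : radialExt (f + g) = radialExt f + radialExt g := by
  funext x
  by_cases hx : x = 0
  · simp [radialExt, hx]
  · simp [radialExt_of_ne _ hx]

lemma radialExt_mul (f g : S2 → ℝ) : radialExt (f * g) = radialExt f * radialExt g := by
  funext x
  by_cases hx : x = 0
  · simp [radialExt, hx]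
  · simp [radialExt_of_ne _ hx]

lemma tder_add {f g : S2 → ℝ} (hf : Smooth f) (hg : Smooth g) (k : Fin 3) (p : S2) :
    tder k (f + g) p = tder k f p + tder k g p := by
  simp only [tder, radialExt_add]
  rw [fderiv_add (differentiableAt_radialExt hf (coe_ne_zero p))
    (differentiableAt_radialExt hg (coe_ne_zero p))]
  rfl

lemma tder_mul {f g : S2 → ℝ} (hf : Smooth f) (hg : Smooth g) (k : Fin 3) (p : S2) :
    tder k (f * g) p = f p * tder k g p + g p * tder k f p := by
  simp only [tder, radialExt_mul]
  rw [fderiv_mul (differentiableAt_radialExt hf (coe_ne_zero p))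
    (differentiableAt_radialExt hg (coe_ne_zero p))]
  simp [radialExt_coe]

lemma tder_comp {f : S2 → ℝ} (hf : Smooth f) {φ : ℝ → ℝ} {φ' : ℝ} {p : S2}
    (hφ : HasDerivAt φ φ' (f p)) (k : Fin 3) : tder k (fun q => φ (f q)) p = φ' * tder k f p := by
  have h : radialExt (fun q => φ (f q)) =ᶠ[nhds (p : E3)] φ ∘ radialExt f := by
    filter_upwards [isOpen_compl_singleton.mem_nhds (coe_ne_zero p)] with x hx
    simp [radialExt_of_ne _ hx]
  rw [tder_eq_of_eventuallyEq h, tder]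
  have h1 := (differentiableAt_radialExt hf (coe_ne_zero p)).hasFDerivAt
  rw [← radialExt_coe f p] at hφ
  rw [(hφ.comp_hasFDerivAt _ h1).fderiv]
  simp

lemma radialExt_inner (a : E3) {x : E3} (hx : x ≠ 0) :
    radialExt (fun p : S2 => inner ℝ a (p : E3)) x = ‖x‖⁻¹ * inner ℝ a x := by
  rw [radialExt_of_ne _ hx]
  simp [toS2, inner_smul_right]

lemma tder_inner (a : E3) (k : Fin 3) (p : S2) :
    tder k (fun q : S2 => inner ℝ a (q : E3)) p
      = a k - inner ℝ a (p : E3) * (p : E3) k := by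
  have h : radialExt (fun q : S2 => inner ℝ a (q : E3)) =ᶠ[nhds (p : E3)]
      fun x => ‖x‖⁻¹ * inner ℝ a x := by
    filter_upwards [isOpen_compl_singleton.mem_nhds (coe_ne_zero p)] with x hx
    exact radialExt_inner a hx
  rw [tder_eq_of_eventuallyEq h]
  have hn : ‖(p : E3)‖ = 1 := norm_eq_of_mem_sphere p
  have h1 := hasFDerivAt_norm_coe p
  have h2 : HasFDerivAt (fun x : E3 => ‖x‖⁻¹) (-(innerSL ℝ (p : E3))) (p : E3) := by
    have := (hasDerivAt_inv (x := ‖(p : E3)‖) (by simp [hn])).comp_hasFDerivAt _ h1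
    simpa [hn, Function.comp_def] using this
  have h3 : HasFDerivAt (fun x : E3 => inner ℝ a x) (innerSL ℝ a) (p : E3) :=
    (innerSL ℝ a).hasFDerivAt
  have h4 := (h2.mul h3).fderiv
  rw [show (fun x : E3 => ‖x‖⁻¹ * inner ℝ a x) = (fun x => ‖x‖⁻¹) * fun x => inner ℝ a x from rfl, h4]
  simp [hn, EuclideanSpace.inner_single_right]
  ring

lemma coord_eq_inner (i : Fin 3) (x : E3) :
    x i = inner ℝ (EuclideanSpace.single i (1 : ℝ)) x := by
  simp [EuclideanSpace.inner_single_left]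

lemma smooth_coord (i : Fin 3) : Smooth fun p : S2 => (p : E3) i :=
  Smooth.of_contDiffAt (fun x => x i) (fun _ => by fun_prop) (fun _ => rfl)

lemma tder_coord (i k : Fin 3) (p : S2) :
    tder k (fun q : S2 => (q : E3) i) p = (if i = k then 1 else 0) - (p : E3) i * (p : E3) k := by
  have := tder_inner (EuclideanSpace.single i (1 : ℝ)) k p
  simp only [← coord_eq_inner] at this
  rw [this]
  simp [eq_comm]

lemma sum_coord_sq (p : S2) : ∑ i, (p : E3) i * (p : E3) i = 1 := by
  have hn : ‖(p : E3)‖ = 1 := norm_eq_of_mem_sphere p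
  have := EuclideanSpace.real_norm_sq_eq (p : E3)
  rw [hn] at this
  simp only [← sq]
  linarith

lemma sum_coord_mul_fderiv (F : E3 → ℝ) (x v : E3) :
    ∑ i, v i * fderiv ℝ F x (EuclideanSpace.single i 1) = fderiv ℝ F x v := by
  conv_rhs => rw [show v = ∑ i, v i • EuclideanSpace.single i (1 : ℝ) by
    ext j; simp [Finset.sum_apply, Pi.single_apply]]
  simp

/-- Euler's relation for the radial extension, which is constant along rays. -/
lemma sum_coord_mul_tder {f : S2 → ℝ} (hf : Smooth f) (p : S2) :
    ∑ i, (p : E3) i * tder i f p = 0 := by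
  simp only [tder, sum_coord_mul_fderiv]
  have h1 := (differentiableAt_radialExt hf (coe_ne_zero p)).hasFDerivAt
  have h2 : HasDerivAt (fun r : ℝ => r • (p : E3)) (p : E3) 1 := by
    simpa using (hasDerivAt_id (1 : ℝ)).smul_const (p : E3)
  have h3 : HasDerivAt (fun r : ℝ => radialExt f (r • (p : E3)))
      (fderiv ℝ (radialExt f) p p) 1 :=
    HasFDerivAt.comp_hasDerivAt (l := radialExt f) (l' := fderiv ℝ (radialExt f) p) (1 : ℝ)
      (by simpa using h1) h2
  have h4 : (fun r : ℝ => radialExt f (r • (p : E3))) =ᶠ[nhds 1] fun _ => radialExt f p := by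
    filter_upwards [lt_mem_nhds one_pos] with r hr
    exact radialExt_smul f hr _
  exact (h3.congr_of_eventuallyEq h4.symm).unique (hasDerivAt_const _ _)

/-- Differentiating `‖x‖ * ∂_b` of the extension gives a symmetric second derivative plus the term
`x_a * d_b f` from the norm; only the latter survives antisymmetrisation. -/
lemma tder_comm {f : S2 → ℝ} (hf : Smooth f) (j k : Fin 3) (p : S2) :
    tder j (tder k f) p - tder k (tder j f) p
      = (p : E3) j * tder k f p - (p : E3) k * tder j f p := by
  have hn : ‖(p : E3)‖ = 1 := norm_eq_of_mem_sphere p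
  have h1 := hasFDerivAt_norm_coe p
  have hF := contDiffAt_radialExt hf (coe_ne_zero p)
  have hF' : HasFDerivAt (fderiv ℝ (radialExt f)) (fderiv ℝ (fderiv ℝ (radialExt f)) p) (p : E3) :=
    ((hF.fderiv_right (m := 1) (by norm_cast)).differentiableAt (by simp)).hasFDerivAt
  have key : ∀ a b : Fin 3, tder a (tder b f) p = (p : E3) a * tder b f p
      + fderiv ℝ (fderiv ℝ (radialExt f)) p (EuclideanSpace.single a 1)
          (EuclideanSpace.single b 1) := by
    intro a b
    have h : radialExt (tder b f) =ᶠ[nhds (p : E3)]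
        fun x => ‖x‖ * fderiv ℝ (radialExt f) x (EuclideanSpace.single b 1) := by
      filter_upwards [isOpen_compl_singleton.mem_nhds (coe_ne_zero p)] with x hx
      exact radialExt_tder f b hx
    rw [tder_eq_of_eventuallyEq h]
    have h3 := hF'.clm_apply (hasFDerivAt_const (EuclideanSpace.single b (1 : ℝ)) (p : E3))
    have h4 := (h1.mul h3).fderiv
    rw [show (fun x : E3 => ‖x‖ * fderiv ℝ (radialExt f) x (EuclideanSpace.single b 1))
      = (fun x => ‖x‖) * fun x => fderiv ℝ (radialExt f) x (EuclideanSpace.single b 1) from rfl, h4]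
    simp [hn, tder, EuclideanSpace.inner_single_right]
    ring
  have hsymm := (hF.isSymmSndFDerivAt (by simp; norm_cast)) (EuclideanSpace.single j 1)
    (EuclideanSpace.single k 1)
  rw [key j k, key k j, hsymm]
  ring

/-! ### Integration over the sphere -/

instance : IsFiniteMeasure area := inferInstanceAs (IsFiniteMeasure (volume : Measure E3).toSphere)

instance : area.IsOpenPosMeasure :=
  inferInstanceAs (Measure.IsOpenPosMeasure (volume : Measure E3).toSphere)

lemma integrable_of_continuous {V : Type*} [NormedAddCommGroup V] {f : S2 → V}
    (hf : Continuous f) : Integrable f area :=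
  hf.integrable_of_hasCompactSupport (HasCompactSupport.of_compactSpace f)

/-- The map of the sphere induced by a linear isometry. -/
def sphereMap (e : E3 ≃ₗᵢ[ℝ] E3) (p : S2) : S2 := ⟨e p, by simp⟩

lemma continuous_sphereMap (e : E3 ≃ₗᵢ[ℝ] E3) : Continuous (sphereMap e) :=
  (e.continuous.comp continuous_subtype_val).subtype_mk _

open Pointwise in
-- Up to a dimensional factor, the area of a set is the volume of the cone over it. Isometries map
-- cones to cones and preserve volume.
lemma measurePreserving_sphereMap (e : E3 ≃ₗᵢ[ℝ] E3) :
    MeasurePreserving (sphereMap e) area area := by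
  refine ⟨(continuous_sphereMap e).measurable, ?_⟩
  ext s hs
  rw [Measure.map_apply (continuous_sphereMap e).measurable hs, area,
    Measure.toSphere_apply' _ ((continuous_sphereMap e).measurable hs),
    Measure.toSphere_apply' _ hs]
  congr 1
  have h : Set.Ioo (0 : ℝ) 1 • ((↑) '' (sphereMap e ⁻¹' s) : Set E3)
      = e ⁻¹' (Set.Ioo (0 : ℝ) 1 • ((↑) '' s : Set E3)) := by
    ext x
    simp only [Set.mem_smul, Set.mem_preimage, Set.mem_image]
    constructor
    · rintro ⟨r, hr, _, ⟨y, hy, rfl⟩, rfl⟩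
      exact ⟨r, hr, _, ⟨_, hy, rfl⟩, by simp [sphereMap]⟩
    · rintro ⟨r, hr, _, ⟨y, hy, rfl⟩, h⟩
      refine ⟨r, hr, _, ⟨sphereMap e.symm y, ?_, rfl⟩, ?_⟩
      · simpa [sphereMap] using hy
      · apply e.injective
        simpa [sphereMap] using h
  rw [h]
  exact e.measurePreserving.measure_preimage_equiv (f := e.toHomeomorph.toMeasurableEquiv) _

lemma integral_sphereMap (e : E3 ≃ₗᵢ[ℝ] E3) {f : S2 → ℝ} (hf : Continuous f) :
    ∫ p, f (sphereMap e p) ∂area = ∫ p, f p ∂area := by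
  have h := measurePreserving_sphereMap e
  conv_rhs => rw [← h.map_eq]
  rw [integral_map h.measurable.aemeasurable hf.aestronglyMeasurable]

lemma continuous_slice {V : Type} [NormedAddCommGroup V] {Φ : E3 × E3 → V} (hΦ : ContinuousOn Φ ({0}ᶜ ×ˢ {0}ᶜ)) {v : E3}
    (hv : v ≠ 0) : Continuous fun y : S2 => Φ (v, y) :=
  hΦ.comp_continuous (by fun_prop) fun y => ⟨hv, coe_ne_zero y⟩

/-! ### Smooth dependence on parameters of integrals over the sphere. -/

section Parametric

variable {V : Type} [NormedAddCommGroup V] [NormedSpace ℝ V]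

lemma isOpen_compl_zero_prod : IsOpen (({0}ᶜ : Set E3) ×ˢ ({0}ᶜ : Set E3)) :=
  isOpen_compl_singleton.prod isOpen_compl_singleton

lemma hasFDerivAt_of_contDiffOn {Φ : E3 × E3 → V}
    (hΦ : ContDiffOn ℝ ∞ Φ ({0}ᶜ ×ˢ {0}ᶜ)) {v : E3} (hv : v ≠ 0) (y : S2) :
    HasFDerivAt Φ (fderiv ℝ Φ (v, y)) (v, (y : E3)) := by
  have hm : (v, (y : E3)) ∈ ({0}ᶜ : Set E3) ×ˢ ({0}ᶜ : Set E3) := ⟨hv, coe_ne_zero y⟩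
  exact ((hΦ.contDiffAt (isOpen_compl_zero_prod.mem_nhds hm)).differentiableAt
    (by simp)).hasFDerivAt

lemma hasDerivAt_slice {Φ : E3 × E3 → V}
    (hΦ : ContDiffOn ℝ ∞ Φ ({0}ᶜ ×ˢ {0}ᶜ)) {v : E3} (hv : v ≠ 0) (w : E3) (y : S2) :
    HasDerivAt (fun t : ℝ => Φ (v + t • w, y))
      ((fderiv ℝ Φ (v, y)).comp (ContinuousLinearMap.inl ℝ E3 E3) w) 0 := by
  have hline : HasDerivAt (fun t : ℝ => (v + t • w, (y : E3))) (w, 0) 0 := by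
    refine HasDerivAt.prodMk ?_ (hasDerivAt_const _ _)
    simpa using ((hasDerivAt_id (0 : ℝ)).smul_const w).const_add v
  exact HasFDerivAt.comp_hasDerivAt (l := Φ) (l' := fderiv ℝ Φ (v, y)) (0 : ℝ)
    (by simpa using hasFDerivAt_of_contDiffOn hΦ hv y) hline

lemma hasFDerivAt_sphere_integral {Φ : E3 × E3 → V}
    (hΦ : ContDiffOn ℝ ∞ Φ ({0}ᶜ ×ˢ {0}ᶜ)) {g : S2 → ℝ} (hg : Continuous g) {v : E3}
    (hv : v ≠ 0) :
    HasFDerivAt (fun v => ∫ y : S2, g y • Φ (v, y) ∂area)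
      (∫ y : S2, g y • (fderiv ℝ Φ (v, y)).comp (ContinuousLinearMap.inl ℝ E3 E3) ∂area) v := by
  have hd : ContinuousOn (fderiv ℝ Φ) ({0}ᶜ ×ˢ {0}ᶜ) :=
    ((contDiffOn_infty_iff_fderiv_of_isOpen isOpen_compl_zero_prod).1 hΦ).2.continuousOn
  have hd' : ContinuousOn (fun z => (fderiv ℝ Φ z).comp (ContinuousLinearMap.inl ℝ E3 E3))
      ({0}ᶜ ×ˢ {0}ᶜ) := hd.clm_comp continuousOn_const
  have hvpos : 0 < ‖v‖ := norm_pos_iff.2 hv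
  -- A compact neighbourhood of v away from the origin: the derivative is bounded on its product
  -- with the sphere, which supplies the dominating function.
  have hball : Metric.closedBall v (‖v‖ / 2) ⊆ {0}ᶜ := by
    intro w hw h0
    rw [Set.mem_singleton_iff.1 h0, Metric.mem_closedBall, dist_zero_left] at hw
    linarith
  have hcpt : IsCompact (Metric.closedBall v (‖v‖ / 2) ×ˢ Metric.sphere (0 : E3) 1) :=
    (isCompact_closedBall _ _).prod (isCompact_sphere _ _)
  obtain ⟨M, hM⟩ := hcpt.exists_bound_of_continuousOn (hd'.mono (Set.prod_mono hball
    (fun y hy => coe_ne_zero ⟨y, hy⟩)))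
  refine hasFDerivAt_integral_of_dominated_of_fderiv_le (𝕜 := ℝ)
    (s := Metric.closedBall v (‖v‖ / 2)) (bound := fun y => |g y| * M)
    (F' := fun w y => g y • (fderiv ℝ Φ (w, y)).comp (ContinuousLinearMap.inl ℝ E3 E3))
    (Metric.closedBall_mem_nhds _ (by positivity)) ?_ ?_ ?_ ?_ ?_ ?_
  · filter_upwards [isOpen_compl_singleton.mem_nhds hv] with w hw
    exact (hg.smul (continuous_slice hΦ.continuousOn hw)).aestronglyMeasurable
  · exact integrable_of_continuous (hg.smul (continuous_slice hΦ.continuousOn hv))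
  · exact (hg.smul (continuous_slice hd' hv)).aestronglyMeasurable
  · refine Filter.Eventually.of_forall fun y w hw => ?_
    rw [norm_smul, Real.norm_eq_abs]
    exact mul_le_mul_of_nonneg_left (hM (w, y) ⟨hw, y.2⟩) (abs_nonneg _)
  · exact integrable_of_continuous (by fun_prop)
  · refine Filter.Eventually.of_forall fun y w hw => ?_
    have h1 := hasFDerivAt_of_contDiffOn hΦ (hball hw) y
    exact (h1.comp w (hasFDerivAt_prodMk_left w (y : E3))).const_smul (g y)

/-- The target space is quantified inside the induction because the derivative of the integral is
again such an integral, with values in a space of linear maps. -/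
lemma contDiffOn_sphere_integral_nat (n : ℕ) :
    ∀ {V : Type} [NormedAddCommGroup V] [NormedSpace ℝ V] {Φ : E3 × E3 → V}
    (_ : ContDiffOn ℝ ∞ Φ ({0}ᶜ ×ˢ {0}ᶜ)) {g : S2 → ℝ} (_ : Continuous g),
    ContDiffOn ℝ n (fun v => ∫ y : S2, g y • Φ (v, y) ∂area) {0}ᶜ := by
  induction n with
  | zero =>
    intro V _ _ Φ hΦ g hg
    exact contDiffOn_zero.2 fun v hv =>
      (hasFDerivAt_sphere_integral hΦ hg hv).continuousAt.continuousWithinAt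
  | succ n ih =>
    intro V _ _ Φ hΦ g hg
    push_cast
    rw [contDiffOn_succ_iff_fderiv_of_isOpen isOpen_compl_singleton]
    refine ⟨fun v hv => (hasFDerivAt_sphere_integral hΦ hg hv).differentiableAt.differentiableWithinAt,
      by simp, ?_⟩
    have hd := ((contDiffOn_infty_iff_fderiv_of_isOpen isOpen_compl_zero_prod).1 hΦ).2
    have hd' : ContDiffOn ℝ ∞ (fun z => (fderiv ℝ Φ z).comp (ContinuousLinearMap.inl ℝ E3 E3))
      ({0}ᶜ ×ˢ {0}ᶜ) := hd.clm_comp contDiffOn_const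
    exact (ih hd' hg).congr fun v hv => (hasFDerivAt_sphere_integral hΦ hg hv).fderiv

lemma contDiffOn_sphere_integral {Φ : E3 × E3 → V}
    (hΦ : ContDiffOn ℝ ∞ Φ ({0}ᶜ ×ˢ {0}ᶜ)) {g : S2 → ℝ} (hg : Continuous g) :
    ContDiffOn ℝ ∞ (fun v => ∫ y : S2, g y • Φ (v, y) ∂area) {0}ᶜ :=
  contDiffOn_infty.2 fun n => contDiffOn_sphere_integral_nat n hΦ hg

end Parametric

/-- The reflection in the plane orthogonal to `v`. -/
def planeRefl (v : E3) : E3 ≃ₗᵢ[ℝ] E3 := (Submodule.span ℝ {v})ᗮ.reflection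

lemma planeRefl_apply (v y : E3) :
    planeRefl v y = y - (2 * inner ℝ v y / ‖v‖ ^ 2) • v := by
  rw [planeRefl, Submodule.reflection_orthogonal_apply, Submodule.reflection_singleton_apply,
    neg_sub, two_smul, ← add_smul]
  congr 2
  simp
  ring

lemma planeRefl_planeRefl (v y : E3) : planeRefl v (planeRefl v y) = y :=
  Submodule.reflection_reflection _ y

lemma planeRefl_add_of_norm_eq {x y : E3} (h : ‖x‖ = ‖y‖) : planeRefl (x + y) x = -y := by
  have := Submodule.reflection_sub (v := x) (w := -y) (by simpa using h)
  simpa [planeRefl] using this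

lemma contDiffOn_planeRefl :
    ContDiffOn ℝ ∞ (fun z : E3 × E3 => planeRefl z.1 z.2) ({0}ᶜ ×ˢ {0}ᶜ) := by
  simp only [planeRefl_apply]
  intro z hz
  apply ContDiffAt.contDiffWithinAt
  refine contDiffAt_snd.sub (ContDiffAt.fun_smul (ContDiffAt.fun_div ?_ ?_ ?_) contDiffAt_fst)
  · exact contDiffAt_const.mul (contDiffAt_fst.inner ℝ contDiffAt_snd)
  · exact (contDiffAt_fst.norm_sq ℝ)
  · exact pow_ne_zero 2 (norm_ne_zero_iff.2 hz.1)

lemma contDiffOn_radialExt_planeRefl {f : S2 → ℝ} (hf : Smooth f) :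
    ContDiffOn ℝ ∞ (fun z : E3 × E3 => radialExt f (planeRefl z.1 z.2)) ({0}ᶜ ×ˢ {0}ᶜ) :=
  (contDiffOn_radialExt hf).comp contDiffOn_planeRefl fun z hz =>
    (map_ne_zero_iff _ (planeRefl z.1).injective).2 hz.2

lemma radialExt_planeRefl (f : S2 → ℝ) (v : E3) (p : S2) :
    radialExt f (planeRefl v p) = f (sphereMap (planeRefl v) p) :=
  radialExt_coe f (sphereMap (planeRefl v) p)

/-- Convolution of a smooth function with a continuous zonal kernel is smooth. -/
lemma smooth_zonal_convolution {f : S2 → ℝ} (hf : Smooth f) {k : ℝ → ℝ} (hk : Continuous k) :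
    Smooth fun x : S2 => ∫ y : S2, k (inner ℝ (x : E3) (y : E3)) * f y ∂area := by
  -- Substitute the reflection R in the plane orthogonal to x + p. It sends x to -p, so ⟨x, Ry⟩ =
  -- -⟨p, y⟩: the kernel no longer depends on x and need only be continuous, while f(Ry) is smooth
  -- in x where x + p ≠ 0, in particular near p.
  refine Smooth.of_locally fun p => ⟨fun x => ∫ y : S2, k (-(inner ℝ (p : E3) (y : E3))) •
    radialExt f (planeRefl (x + p) y) ∂area, ?_, ?_⟩
  · have h1 := contDiffOn_sphere_integral (contDiffOn_radialExt_planeRefl hf)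
      (g := fun y : S2 => k (-(inner ℝ (p : E3) (y : E3))))
      (hk.comp ((continuous_const.inner continuous_subtype_val).neg))
    have hpp : (p : E3) + p ≠ 0 := by
      rw [← two_smul ℝ]
      exact smul_ne_zero two_ne_zero (coe_ne_zero p)
    have h2 := h1.contDiffAt (isOpen_compl_singleton.mem_nhds hpp)
    exact ContDiffAt.comp (f := fun x : E3 => x + p) (p : E3) h2
      (contDiffAt_id.add contDiffAt_const)
  · refine Filter.Eventually.of_forall fun q => ?_
    have hc : Continuous fun y : S2 => k (inner ℝ (q : E3) (y : E3)) * f y :=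
      (hk.comp (continuous_const.inner continuous_subtype_val)).mul hf.continuous
    change ∫ y : S2, k (inner ℝ (q : E3) (y : E3)) * f y ∂area = _
    rw [← integral_sphereMap (planeRefl (q + p)) hc]
    refine integral_congr_ae (Filter.Eventually.of_forall fun y => ?_)
    have h1 : inner ℝ (q : E3) (planeRefl (q + p) y) = -inner ℝ (p : E3) (y : E3) := by
      rw [← (planeRefl ((q : E3) + p)).inner_map_map, planeRefl_planeRefl,
        planeRefl_add_of_norm_eq (by simp), inner_neg_left]
    simp only [radialExt_planeRefl, smul_eq_mul]
    rw [← h1]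
    rfl

/-- The integral of the derivative along a rotation field vanishes. -/
lemma integral_rotation {f : S2 → ℝ} (hf : Smooth f) {j k : Fin 3} (hjk : j ≠ k) :
    ∫ p : S2, ((p : E3) j * tder k f p - (p : E3) k * tder j f p) ∂area = 0 := by
  set ej : E3 := EuclideanSpace.single j 1 with hej
  set ek : E3 := EuclideanSpace.single k 1 with hek
  have hej0 : ej ≠ 0 := by simp [hej]
  -- The integral of f composed with the reflection along v does not depend on v. Its derivative at
  -- v = e_j in the direction e_k is twice the integral of the rotation derivative, pulled back by
  -- the reflection along e_j.
  have h1 := hasFDerivAt_sphere_integral (contDiffOn_radialExt_planeRefl hf)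
    (g := fun _ => (1 : ℝ)) continuous_const hej0
  have hconst : (fun v : E3 => ∫ y : S2, (1 : ℝ) • radialExt f (planeRefl v y) ∂area)
      = fun _ => ∫ y, f y ∂area := by
    funext v
    simp only [one_smul, radialExt_planeRefl]
    exact integral_sphereMap _ hf.continuous
  simp only [one_smul] at h1 hconst
  rw [hconst] at h1
  have h2 := congrArg (fun l => l ek) (h1.unique (hasFDerivAt_const _ _))
  have hd := ((contDiffOn_infty_iff_fderiv_of_isOpen isOpen_compl_zero_prod).1
    (contDiffOn_radialExt_planeRefl hf)).2.continuousOn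
  have hd' : ContinuousOn (fun z => (fderiv ℝ (fun z : E3 × E3 =>
      radialExt f (planeRefl z.1 z.2)) z).comp (ContinuousLinearMap.inl ℝ E3 E3))
      ({0}ᶜ ×ˢ {0}ᶜ) := hd.clm_comp continuousOn_const
  simp only [zero_apply] at h2
  rw [ContinuousLinearMap.integral_apply
    (integrable_of_continuous (continuous_slice hd' hej0))] at h2
  have hc1 : ∀ i, Continuous fun p : S2 => (p : E3) i := fun i => (smooth_coord i).continuous
  have key : ∀ y : S2, ((fderiv ℝ (fun z : E3 × E3 =>
      radialExt f (planeRefl z.1 z.2)) (ej, y)).comp (ContinuousLinearMap.inl ℝ E3 E3)) ek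
      = (fun p : S2 => 2 * ((p : E3) j * tder k f p - (p : E3) k * tder j f p))
        (sphereMap (planeRefl ej) y) := by
    intro y
    set q := sphereMap (planeRefl ej) y with hq
    have hqy : (y : E3) = planeRefl ej q := (planeRefl_planeRefl ej y).symm
    have hqE : (q : E3) = planeRefl ej y := rfl
    have hA := hasDerivAt_slice (contDiffOn_radialExt_planeRefl hf) hej0 ek y
    have hyj : inner ℝ ej (y : E3) = (y : E3) j := (coord_eq_inner _ _).symm
    have hyk : inner ℝ ek (y : E3) = (y : E3) k := (coord_eq_inner _ _).symm
    have hnorm : ∀ t : ℝ, ‖ej + t • ek‖ ^ 2 = 1 + t ^ 2 := by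
      intro t
      have h0 : inner ℝ ej (t • ek) = 0 := by
        simp [hej, hek, EuclideanSpace.inner_single_left, hjk]
      rw [norm_add_sq_real, h0, norm_smul]
      simp [hej, hek]
    -- Since ‖e_j + t e_k‖² = 1 + t², the normalisation of the reflection does not contribute to
    -- first order.
    have hB : HasDerivAt (fun t : ℝ => planeRefl (ej + t • ek) y)
        (-((2 * (y : E3) k) • ej + (2 * (y : E3) j) • ek)) 0 := by
      have hs : HasDerivAt (fun t : ℝ => 2 * inner ℝ (ej + t • ek) (y : E3) / ‖ej + t • ek‖ ^ 2)
          (2 * (y : E3) k) 0 := by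
        have hfun : (fun t : ℝ => 2 * inner ℝ (ej + t • ek) (y : E3) / ‖ej + t • ek‖ ^ 2)
            = fun t => 2 * ((y : E3) j + t * (y : E3) k) / (1 + t ^ 2) := by
          funext t
          rw [hnorm, inner_add_left, inner_smul_left, hyj, hyk]
          simp
        rw [hfun]
        have hn : HasDerivAt (fun t : ℝ => 2 * ((y : E3) j + t * (y : E3) k)) (2 * (y : E3) k) 0 := by
          simpa using (((hasDerivAt_id (0 : ℝ)).mul_const ((y : E3) k)).const_add
            ((y : E3) j)).const_mul 2
        have hden : HasDerivAt (fun t : ℝ => 1 + t ^ 2) 0 0 := by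
          simpa using ((hasDerivAt_id (0 : ℝ)).pow 2).const_add 1
        simpa using hn.fun_div hden (by simp)
      have hv : HasDerivAt (fun t : ℝ => ej + t • ek) ek 0 := by
        simpa using ((hasDerivAt_id (0 : ℝ)).smul_const ek).const_add ej
      simp only [planeRefl_apply]
      refine ((hs.fun_smul hv).const_sub (y : E3)).congr_deriv ?_
      have := hnorm 0
      simp only [zero_smul, add_zero] at this ⊢
      rw [hyj, this]
      simp [add_comm]
    have hF : HasFDerivAt (radialExt f) (fderiv ℝ (radialExt f) q) (q : E3) :=
      (differentiableAt_radialExt hf (coe_ne_zero q)).hasFDerivAt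
    have hC : HasDerivAt (fun t : ℝ => radialExt f (planeRefl (ej + t • ek) y)) _ 0 :=
      HasFDerivAt.comp_hasDerivAt (l := radialExt f) (l' := fderiv ℝ (radialExt f) q) (0 : ℝ)
        (by simp only [zero_smul, add_zero]; exact hF) hB
    have huniq := hA.unique hC
    rw [huniq]
    -- Expressed at the reflected point q, the velocity is 2(q_j e_k - q_k e_j); invariance of the
    -- area measure then removes the reflection from the integral.
    have e1 : (y : E3) j = -(q : E3) j := by
      rw [hqE, planeRefl_apply, hyj]; simp [hej]; ring
    have e2 : (y : E3) k = (q : E3) k := by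
      rw [hqE, planeRefl_apply, hyj]; simp [hej, hjk.symm]
    rw [e1, e2]
    simp only [map_neg, map_add, map_smul, smul_eq_mul, tder]
    ring
  simp only [key] at h2
  have hcont : Continuous (fun p : S2 => 2 * ((p : E3) j * tder k f p - (p : E3) k * tder j f p)) :=
    continuous_const.mul (((hc1 j).mul (hf.tder k).continuous).sub
      ((hc1 k).mul (hf.tder j).continuous))
  rw [integral_sphereMap (planeRefl ej) hcont, integral_const_mul] at h2
  simpa using h2

/-! ### The algebra of tangential derivatives

The identities of tensor calculus on the sphere are consequences of a few relations between the
Cartesian coordinates, the tangential derivatives and the integral, in the commutative algebra of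
smooth functions. -/

/-- Coordinates `x i`, tangential derivatives `d i` and an integral on a commutative algebra,
satisfying the relations that hold on the unit sphere of Euclidean three-space. -/
structure SphereCalculus (A : Type*) [CommRing A] [Algebra ℝ A] where
  /-- The tangential derivatives. -/
  d : Fin 3 → Derivation ℝ A A
  /-- The Cartesian coordinates. -/
  x : Fin 3 → A
  /-- The integral. -/
  integral : A →ₗ[ℝ] ℝ
  sum_x_mul_x : ∑ i, x i * x i = 1
  sum_x_mul_d : ∀ f, ∑ i, x i * d i f = 0
  d_x : ∀ k i, d k (x i) = (if i = k then 1 else 0) - x i * x k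
  d_d : ∀ j k f, d j (d k f) = d k (d j f) + x j * d k f - x k * d j f
  integral_d : ∀ k f, integral (d k f) = 2 * integral (x k * f)
  integral_mul_self_nonneg : ∀ f, 0 ≤ integral (f * f)
  eq_zero_of_integral_mul_self : ∀ f, integral (f * f) = 0 → f = 0

namespace SphereCalculus

variable {A : Type*} [CommRing A] [Algebra ℝ A] (S : SphereCalculus A)

/-- The Laplacian. -/
def lap (f : A) : A := ∑ i, S.d i (S.d i f)

/-- The scalar product of gradients. -/
def gdot (f g : A) : A := ∑ i, S.d i f * S.d i g

/-- The area form. -/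
def E : Fin 3 → Fin 3 → A :=
  ![![0, S.x 2, -S.x 1], ![-S.x 2, 0, S.x 0], ![S.x 1, -S.x 0, 0]]

/-- Rotation of a one-form by a right angle. -/
def star (w : Fin 3 → A) (i : Fin 3) : A := ∑ k, S.E i k * w k

/-- Rotation of the first index of a tensor by a right angle. -/
def starT (T : Fin 3 → Fin 3 → A) (i j : Fin 3) : A := ∑ k, S.E i k * T k j

/-- The gradient. -/
def grad (f : A) (i : Fin 3) : A := S.d i f

/-- The divergence of a tangential one-form. -/
def div (w : Fin 3 → A) : A := ∑ i, S.d i (w i)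

/-- The divergence of a symmetric traceless tensor. -/
def divT (T : Fin 3 → Fin 3 → A) (i : Fin 3) : A := ∑ j, S.d j (T i j)

/-- Twice the traceless Hessian. -/
def shear (c : A) (i j : Fin 3) : A :=
  2 * (S.d j (S.d i c) + S.x i * S.d j c) - ((if i = j then 1 else 0) - S.x i * S.x j) * S.lap c

/-- Tangential symmetric traceless tensors. -/
structure IsSTT (T : Fin 3 → Fin 3 → A) : Prop where
  symm : ∀ i j, T i j = T j i
  tang : ∀ i, ∑ j, T i j * S.x j = 0
  trace : ∑ i, T i i = 0

/-- Tangential one-forms. -/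
def Tang (w : Fin 3 → A) : Prop := ∑ i, w i * S.x i = 0

/-! ### Laplacian and commutation identities. -/

lemma x_sq : S.x 0 * S.x 0 + S.x 1 * S.x 1 + S.x 2 * S.x 2 = 1 := by
  simpa [Fin.sum_univ_three] using S.sum_x_mul_x

lemma x_d (f : A) : S.x 0 * S.d 0 f + S.x 1 * S.d 1 f + S.x 2 * S.d 2 f = 0 := by
  simpa [Fin.sum_univ_three] using S.sum_x_mul_d f

lemma lap_eq (f : A) : S.lap f = S.d 0 (S.d 0 f) + S.d 1 (S.d 1 f) + S.d 2 (S.d 2 f) := by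
  simp [lap, Fin.sum_univ_three]

lemma lap_add (f g : A) : S.lap (f + g) = S.lap f + S.lap g := by
  simp [lap, Finset.sum_add_distrib]

lemma lap_sub (f g : A) : S.lap (f - g) = S.lap f - S.lap g := by
  simp [lap, Finset.sum_sub_distrib]

lemma lap_neg (f : A) : S.lap (-f) = -S.lap f := by
  simp [lap]

lemma lap_smul (r : ℝ) (f : A) : S.lap (r • f) = r • S.lap f := by
  simp [lap, Finset.smul_sum]

lemma d_algebraMap (k : Fin 3) (r : ℝ) : S.d k (algebraMap ℝ A r) = 0 := by simp

lemma lap_algebraMap (r : ℝ) : S.lap (algebraMap ℝ A r) = 0 := by simp [lap]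

lemma d_two (k : Fin 3) : S.d k (2 : A) = 0 := by
  exact_mod_cast (S.d k).map_natCast 2

lemma d_two_mul (k : Fin 3) (f : A) : S.d k (2 * f) = 2 * S.d k f := by
  rw [two_mul, map_add, two_mul]

lemma lap_two_mul (f : A) : S.lap (2 * f) = 2 * S.lap f := by
  rw [two_mul, lap_add, two_mul]

lemma lap_mul (f g : A) : S.lap (f * g) = f * S.lap g + g * S.lap f + 2 * S.gdot f g := by
  simp only [lap_eq, gdot, Fin.sum_univ_three, Derivation.leibniz, smul_eq_mul, map_add]
  ring

lemma x_d_of_tang {w : Fin 3 → A} (hw : S.Tang w) (j : Fin 3) :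
    S.x 0 * S.d j (w 0) + S.x 1 * S.d j (w 1) + S.x 2 * S.d j (w 2) = -w j := by
  have h : w 0 * S.x 0 + w 1 * S.x 1 + w 2 * S.x 2 = 0 := by
    simpa [Tang, Fin.sum_univ_three] using hw
  have h' := congrArg (S.d j) h
  simp only [map_add, Derivation.leibniz, smul_eq_mul, S.d_x, map_zero] at h'
  fin_cases j <;> simp at h' ⊢
  · linear_combination h' + S.x 0 * h
  · linear_combination h' + S.x 1 * h
  · linear_combination h' + S.x 2 * h

lemma tang_grad (f : A) : S.Tang (S.grad f) := by
  have := S.sum_x_mul_d f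
  simpa [Tang, grad, mul_comm] using this

lemma x_d_d (f : A) (j : Fin 3) :
    S.x 0 * S.d j (S.d 0 f) + S.x 1 * S.d j (S.d 1 f) + S.x 2 * S.d j (S.d 2 f) = -S.d j f :=
  S.x_d_of_tang (S.tang_grad f) j

lemma d_d_d (f : A) (i j : Fin 3) : S.d j (S.d j (S.d i f))
    = S.d i (S.d j (S.d j f)) + S.x j * S.d i (S.d j f) - S.x i * S.d j (S.d j f)
      + (S.x j * S.d j (S.d i f) + (1 - S.x j * S.x j) * S.d i f)
      - (S.x i * S.d j (S.d j f) + ((if i = j then 1 else 0) - S.x i * S.x j) * S.d j f) := by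
  have h := congrArg (S.d j) (S.d_d j i f)
  simp only [map_add, map_sub, Derivation.leibniz, smul_eq_mul, S.d_x, if_true] at h
  rw [S.d_d j i (S.d j f)] at h
  linear_combination h

/-- The trace of `d_d_d`. The commutator terms stand in for the curvature of the sphere. -/
lemma lap_d (f : A) (i : Fin 3) :
    S.lap (S.d i f) = S.d i (S.lap f) - 2 * S.x i * S.lap f := by
  have h1 := S.x_sq
  have h2 := S.x_d f
  have h3 := S.x_d (S.d i f)
  have h4 := S.x_d_d f i
  rw [lap_eq, lap_eq, S.d_d_d f i 0, S.d_d_d f i 1, S.d_d_d f i 2]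
  simp only [map_add]
  fin_cases i <;> simp at h3 h4 ⊢
  · linear_combination h3 + h4 - S.d 0 f * h1 + S.x 0 * h2
  · linear_combination h3 + h4 - S.d 1 f * h1 + S.x 1 * h2
  · linear_combination h3 + h4 - S.d 2 f * h1 + S.x 2 * h2

/-! ### Symmetric traceless tensors, rotation by a right angle, divergence and curl. -/

lemma shear_symm (c : A) (i j : Fin 3) : S.shear c i j = S.shear c j i := by
  simp only [shear, S.d_d j i c, eq_comm (a := i) (b := j)]
  ring

lemma isSTT_shear (c : A) : S.IsSTT (S.shear c) where
  symm := S.shear_symm c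
  tang i := by
    have h0 := S.x_sq
    have h1 := S.x_d c
    have h2 := S.x_d (S.d i c)
    fin_cases i <;> simp [shear, Fin.sum_univ_three] at h2 ⊢
    · linear_combination 2 * h2 + 2 * S.x 0 * h1 + S.x 0 * S.lap c * h0
    · linear_combination 2 * h2 + 2 * S.x 1 * h1 + S.x 1 * S.lap c * h0
    · linear_combination 2 * h2 + 2 * S.x 2 * h1 + S.x 2 * S.lap c * h0
  trace := by
    have h0 := S.x_sq
    have h1 := S.x_d c
    have h2 := S.lap_eq c
    simp only [shear, Fin.sum_univ_three, if_true]
    linear_combination -2 * h2 + 2 * h1 + S.lap c * h0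

/-- Commuting derivatives gives div(2∇∇c - h D²c) = ∇D²c + 2 Ric(∇c), and Ric = h on the unit
sphere. -/
lemma divT_shear (c : A) (i : Fin 3) :
    S.divT (S.shear c) i = S.d i (S.lap c + 2 * c) := by
  have h0 := S.x_sq
  have h1 := S.x_d c
  have h2 := S.x_d (S.lap c)
  have h3 := S.lap_d c i
  have h4 := S.lap_eq c
  rw [S.lap_eq (S.d i c)] at h3
  simp only [divT, shear, Fin.sum_univ_three, map_sub, map_add, Derivation.leibniz, smul_eq_mul,
    S.d_x, d_two]
  fin_cases i <;> simp at h3 ⊢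
  · linear_combination 2 * h3 - 2 * S.x 0 * h4 - 2 * S.x 0 * h1 + S.x 0 * h2
      - 2 * S.x 0 * S.lap c * h0
  · linear_combination 2 * h3 - 2 * S.x 1 * h4 - 2 * S.x 1 * h1 + S.x 1 * h2
      - 2 * S.x 1 * S.lap c * h0
  · linear_combination 2 * h3 - 2 * S.x 2 * h4 - 2 * S.x 2 * h1 + S.x 2 * h2
      - 2 * S.x 2 * S.lap c * h0

variable {S} in
-- A two-dimensional fact: rotation exchanges the conditions. Symmetry of the rotated tensor comes
-- from the trace and tangentiality of T, its trace from the symmetry of T.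
lemma IsSTT.starT {T : Fin 3 → Fin 3 → A} (hT : S.IsSTT T) : S.IsSTT (S.starT T) := by
  have t0 := hT.tang 0
  have t1 := hT.tang 1
  have t2 := hT.tang 2
  have tr := hT.trace
  have s10 := hT.symm 1 0
  have s20 := hT.symm 2 0
  have s21 := hT.symm 2 1
  simp only [Fin.sum_univ_three] at t0 t1 t2 tr
  have a01 : S.starT T 0 1 = S.starT T 1 0 := by
    simp [SphereCalculus.starT, E, Fin.sum_univ_three]
    linear_combination S.x 2 * tr - t2
  have a02 : S.starT T 0 2 = S.starT T 2 0 := by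
    simp [SphereCalculus.starT, E, Fin.sum_univ_three]
    linear_combination -S.x 1 * tr + t1
  have a12 : S.starT T 1 2 = S.starT T 2 1 := by
    simp [SphereCalculus.starT, E, Fin.sum_univ_three]
    linear_combination S.x 0 * tr - t0
  refine ⟨?_, ?_, ?_⟩
  · intro i j
    fin_cases i <;> fin_cases j <;>
      first
      | rfl | exact a01 | exact a02 | exact a12 | exact a01.symm | exact a02.symm | exact a12.symm
  · intro i
    fin_cases i <;> simp [SphereCalculus.starT, E, Fin.sum_univ_three]
    · linear_combination S.x 2 * t1 - S.x 1 * t2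
    · linear_combination -S.x 2 * t0 + S.x 0 * t2
    · linear_combination S.x 1 * t0 - S.x 0 * t1
  · simp [SphereCalculus.starT, E, Fin.sum_univ_three]
    linear_combination S.x 2 * s10 - S.x 1 * s20 + S.x 0 * s21

variable {S} in
lemma IsSTT.sub {T T' : Fin 3 → Fin 3 → A} (hT : S.IsSTT T) (hT' : S.IsSTT T') :
    S.IsSTT fun i j => T i j - T' i j where
  symm i j := by rw [hT.symm i j, hT'.symm i j]
  tang i := by simp only [sub_mul, Finset.sum_sub_distrib, hT.tang i, hT'.tang i, sub_zero]
  trace := by simp only [Finset.sum_sub_distrib, hT.trace, hT'.trace, sub_zero]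

variable {S} in
lemma IsSTT.add {T T' : Fin 3 → Fin 3 → A} (hT : S.IsSTT T) (hT' : S.IsSTT T') :
    S.IsSTT fun i j => T i j + T' i j where
  symm i j := by rw [hT.symm i j, hT'.symm i j]
  tang i := by simp only [add_mul, Finset.sum_add_distrib, hT.tang i, hT'.tang i, add_zero]
  trace := by simp only [Finset.sum_add_distrib, hT.trace, hT'.trace, add_zero]

/-- The area form is parallel, so rotation commutes with the divergence. The terms from
differentiating its Cartesian components cancel by symmetry and tangentiality. -/
lemma divT_starT {T : Fin 3 → Fin 3 → A} (hT : S.IsSTT T) (i : Fin 3) :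
    S.divT (S.starT T) i = S.star (S.divT T) i := by
  have t0 := hT.tang 0
  have t1 := hT.tang 1
  have t2 := hT.tang 2
  have s10 := hT.symm 1 0
  have s20 := hT.symm 2 0
  have s21 := hT.symm 2 1
  simp only [Fin.sum_univ_three] at t0 t1 t2
  fin_cases i <;>
    simp [SphereCalculus.starT, star, divT, E, Fin.sum_univ_three, S.d_x]
  · linear_combination -s21 - S.x 2 * t1 + S.x 1 * t2
  · linear_combination s20 + S.x 2 * t0 - S.x 0 * t2
  · linear_combination -s10 - S.x 1 * t0 + S.x 0 * t1

lemma star_star {w : Fin 3 → A} (hw : S.Tang w) (i : Fin 3) : S.star (S.star w) i = -w i := by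
  have h0 := S.x_sq
  have h : w 0 * S.x 0 + w 1 * S.x 1 + w 2 * S.x 2 = 0 := by
    simpa [Tang, Fin.sum_univ_three] using hw
  fin_cases i <;> simp [star, E, Fin.sum_univ_three]
  · linear_combination S.x 0 * h - w 0 * h0
  · linear_combination S.x 1 * h - w 1 * h0
  · linear_combination S.x 2 * h - w 2 * h0

lemma tang_star (w : Fin 3 → A) : S.Tang (S.star w) := by
  simp [Tang, star, E, Fin.sum_univ_three]
  ring

lemma star_add (v w : Fin 3 → A) (i : Fin 3) :
    S.star (fun i => v i + w i) i = S.star v i + S.star w i := by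
  simp [star, mul_add, Finset.sum_add_distrib]

lemma div_star (w : Fin 3 → A) : S.div (S.star w)
    = S.x 0 * (S.d 1 (w 2) - S.d 2 (w 1)) + S.x 1 * (S.d 2 (w 0) - S.d 0 (w 2))
      + S.x 2 * (S.d 0 (w 1) - S.d 1 (w 0)) := by
  simp [star, div, E, Fin.sum_univ_three, S.d_x]
  ring

lemma div_star_grad (f : A) : S.div (S.star (S.grad f)) = 0 := by
  rw [div_star]
  simp only [grad]
  rw [S.d_d 1 2 f, S.d_d 2 0 f, S.d_d 0 1 f]
  ring

lemma div_grad (f : A) : S.div (S.grad f) = S.lap f := rfl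

/-! #### Integration by parts -/

/-- The axiom `integral_d` leaves twice the integral of the normal component of w, which is zero. -/
lemma integral_div {w : Fin 3 → A} (hw : S.Tang w) : S.integral (S.div w) = 0 := by
  have h : ∑ i, S.x i * w i = 0 := by
    simpa [Tang, mul_comm] using hw
  rw [div, map_sum]
  simp only [S.integral_d, ← Finset.mul_sum, ← map_sum, h, map_zero, mul_zero]

lemma div_mul (f : A) (w : Fin 3 → A) :
    S.div (fun i => f * w i) = f * S.div w + ∑ i, S.d i f * w i := by
  simp only [div, Derivation.leibniz, smul_eq_mul, Finset.sum_add_distrib, Finset.mul_sum]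
  congr 1
  exact Finset.sum_congr rfl fun i _ => mul_comm _ _

lemma integral_mul_div (f : A) {w : Fin 3 → A} (hw : S.Tang w) :
    S.integral (f * S.div w) = -S.integral (∑ i, S.d i f * w i) := by
  have h : S.Tang fun i => f * w i := by
    simp only [Tang, mul_assoc, ← Finset.mul_sum]
    rw [show ∑ i, w i * S.x i = 0 from hw, mul_zero]
  have := S.integral_div h
  rw [div_mul, map_add] at this
  linarith

lemma integral_mul_lap (f g : A) : S.integral (f * S.lap g) = -S.integral (S.gdot f g) :=
  S.integral_mul_div f (S.tang_grad g)

lemma gdot_comm (f g : A) : S.gdot f g = S.gdot g f := by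
  simp only [gdot, mul_comm]

lemma integral_lap_comm (f g : A) : S.integral (f * S.lap g) = S.integral (g * S.lap f) := by
  rw [integral_mul_lap, integral_mul_lap, gdot_comm]

/-- A harmonic function has vanishing derivative. -/
lemma d_eq_zero_of_lap_eq_zero {f : A} (hf : S.lap f = 0) (i : Fin 3) : S.d i f = 0 := by
  have h := S.integral_mul_lap f f
  rw [hf, mul_zero, map_zero, gdot, map_sum, zero_eq_neg,
    Finset.sum_eq_zero_iff_of_nonneg fun i _ => S.integral_mul_self_nonneg _] at h
  exact S.eq_zero_of_integral_mul_self _ (h i (Finset.mem_univ i))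

/-- There are no nonzero harmonic one-forms on the sphere. -/
lemma eq_zero_of_div_eq_zero {w : Fin 3 → A} (hw : S.Tang w) (h1 : S.div w = 0)
    (h2 : S.div (S.star w) = 0) (j : Fin 3) : w j = 0 := by
  have hx := S.x_sq
  have ht : w 0 * S.x 0 + w 1 * S.x 1 + w 2 * S.x 2 = 0 := by
    simpa [Tang, Fin.sum_univ_three] using hw
  have hc0 := S.x_d_of_tang hw 0
  have hc1 := S.x_d_of_tang hw 1
  have hc2 := S.x_d_of_tang hw 2
  have g0 := S.x_d (w 0)
  have g1 := S.x_d (w 1)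
  have g2 := S.x_d (w 2)
  rw [div_star] at h2
  -- The antisymmetrised derivative is an ambient vector: its normal component is the vanishing curl
  -- `h2`, and its tangential components are fixed by tangentiality of w and of the derivatives.
  have b12 : S.d 1 (w 2) = S.d 2 (w 1) + S.x 1 * w 2 - S.x 2 * w 1 := by
    linear_combination (-(S.d 1 (w 2) - S.d 2 (w 1))) * hx
      + S.x 0 * h2 + S.x 2 * (hc1 - g1) - S.x 1 * (hc2 - g2)
  have b20 : S.d 2 (w 0) = S.d 0 (w 2) + S.x 2 * w 0 - S.x 0 * w 2 := by
    linear_combination (-(S.d 2 (w 0) - S.d 0 (w 2))) * hx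
      + S.x 1 * h2 + S.x 0 * (hc2 - g2) - S.x 2 * (hc0 - g0)
  have b01 : S.d 0 (w 1) = S.d 1 (w 0) + S.x 0 * w 1 - S.x 1 * w 0 := by
    linear_combination (-(S.d 0 (w 1) - S.d 1 (w 0))) * hx
      + S.x 2 * h2 + S.x 1 * (hc0 - g0) - S.x 0 * (hc1 - g1)
  have hb : ∀ i j, S.d i (w j) = S.d j (w i) + S.x i * w j - S.x j * w i := by
    intro i j
    fin_cases i <;> fin_cases j <;> simp <;>
      first
      | exact b12 | exact b20 | exact b01 | linear_combination -b12 | linear_combination -b20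
      | linear_combination -b01
  have hdd : ∀ i j, S.d i (S.d i (w j)) = S.d j (S.d i (w i)) + S.x i * S.d j (w i)
      - S.x j * S.d i (w i) + (S.x i * S.d i (w j) + (1 - S.x i * S.x i) * w j)
      - (S.x j * S.d i (w i) + ((if j = i then 1 else 0) - S.x j * S.x i) * w i) := by
    intro i j
    have h := congrArg (S.d i) (hb i j)
    simp only [map_add, map_sub, Derivation.leibniz, smul_eq_mul, S.d_x, if_true] at h
    rw [S.d_d i j (w i)] at h
    linear_combination h
  have hdiv : S.d 0 (w 0) + S.d 1 (w 1) + S.d 2 (w 2) = 0 := by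
    simpa [div, Fin.sum_univ_three] using h1
  -- With curl and divergence zero, each Cartesian component of w is a harmonic function, hence has
  -- vanishing derivative. Differentiating w·x = 0 then returns w itself, which is therefore zero.
  have hlap : ∀ j, S.lap (w j) = 0 := by
    intro j
    have hdiv' := congrArg (S.d j) hdiv
    have hcj := S.x_d_of_tang hw j
    have gj := S.x_d (w j)
    rw [lap_eq, hdd 0 j, hdd 1 j, hdd 2 j]
    simp only [map_add, map_zero] at hdiv'
    fin_cases j <;> simp at hdiv' hcj gj ⊢
    · linear_combination hdiv' + hcj + gj - 2 * S.x 0 * hdiv - w 0 * hx + S.x 0 * ht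
    · linear_combination hdiv' + hcj + gj - 2 * S.x 1 * hdiv - w 1 * hx + S.x 1 * ht
    · linear_combination hdiv' + hcj + gj - 2 * S.x 2 * hdiv - w 2 * hx + S.x 2 * ht
  have hd : ∀ i j, S.d i (w j) = 0 := fun i j => S.d_eq_zero_of_lap_eq_zero (hlap j) i
  have := S.x_d_of_tang hw j
  simp only [hd, mul_zero, add_zero] at this
  exact neg_eq_zero.1 this.symm

variable {S} in
lemma IsSTT.tang_row {T : Fin 3 → Fin 3 → A} (hT : S.IsSTT T) (i : Fin 3) : S.Tang (T i) :=
  hT.tang i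

variable {S} in
-- Differentiating tangentiality of the rows shows that the normal component of the unprojected
-- divergence is minus the trace.
lemma IsSTT.tang_divT {T : Fin 3 → Fin 3 → A} (hT : S.IsSTT T) : S.Tang (S.divT T) := by
  have c0 := S.x_d_of_tang (hT.tang_row 0)
  have c1 := S.x_d_of_tang (hT.tang_row 1)
  have c2 := S.x_d_of_tang (hT.tang_row 2)
  have tr := hT.trace
  simp only [Fin.sum_univ_three] at tr
  simp only [Tang, divT, Fin.sum_univ_three]
  rw [hT.symm 0 1, hT.symm 0 2, hT.symm 1 2] at *
  have e0 := c0 0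
  have e1 := c1 1
  have e2 := c2 2
  linear_combination e0 + e1 + e2 - tr

/-- There are no nonzero divergence free symmetric traceless tensors on the sphere. -/
lemma eq_zero_of_divT_eq_zero {T : Fin 3 → Fin 3 → A} (hT : S.IsSTT T)
    (h : ∀ i, S.divT T i = 0) (i j : Fin 3) : T i j = 0 := by
  -- Each Cartesian row of T is a harmonic one-form: its divergence is a component of div T, and its
  -- curl a component of div ⋆T = ⋆ div T.
  refine S.eq_zero_of_div_eq_zero (hT.tang_row i) (h i) ?_ j
  have h1 : S.div (S.star (T i)) = S.divT (S.starT T) i := by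
    refine Finset.sum_congr rfl fun j _ => congrArg (S.d j) ?_
    rw [hT.starT.symm i j]
    exact Finset.sum_congr rfl fun k _ => by rw [hT.symm i k]
  rw [h1, S.divT_starT hT, star]
  simp [h]

/-! #### Linear functions and rotation fields -/

/-- The restriction of the linear form with coefficients `a`. -/
def lin (a : Fin 3 → ℝ) : A := ∑ i, algebraMap ℝ A (a i) * S.x i

lemma d_lin (a : Fin 3 → ℝ) (k : Fin 3) :
    S.d k (S.lin a) = algebraMap ℝ A (a k) - S.lin a * S.x k := by
  simp only [lin, Fin.sum_univ_three, map_add, Derivation.leibniz, smul_eq_mul, S.d_x,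
    d_algebraMap]
  fin_cases k <;> simp <;> ring

lemma lap_lin (a : Fin 3 → ℝ) : S.lap (S.lin a) = -2 * S.lin a := by
  have h0 := S.x_sq
  have h1 := S.x_d (S.lin a)
  simp only [lap_eq]
  rw [S.d_lin, S.d_lin, S.d_lin]
  simp only [map_sub, d_algebraMap, Derivation.leibniz, smul_eq_mul, S.d_x, if_true]
  linear_combination -h1 + S.lin a * h0

lemma gdot_lin (a : Fin 3 → ℝ) (f : A) :
    S.gdot (S.lin a) f = ∑ i, algebraMap ℝ A (a i) * S.d i f := by
  have h1 := S.x_d f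
  simp only [gdot, Fin.sum_univ_three, d_lin]
  linear_combination -S.lin a * h1

lemma lap_gdot_lin (a : Fin 3 → ℝ) (f : A) :
    S.lap (S.gdot (S.lin a) f) = S.gdot (S.lin a) (S.lap f) - 2 * S.lin a * S.lap f := by
  have hc : ∀ (r : ℝ) (g : A), S.lap (algebraMap ℝ A r * g) = algebraMap ℝ A r * S.lap g := by
    intro r g
    rw [← Algebra.smul_def, lap_smul, Algebra.smul_def]
  simp only [gdot_lin, Fin.sum_univ_three, lap_add, hc, lap_d]
  simp only [lin, Fin.sum_univ_three]
  ring

/-- The rotation field `ε^{AD} n_{||D}` of a linear function is Killing. -/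
lemma killing (a : Fin 3 → ℝ) {T : Fin 3 → Fin 3 → A} (hT : S.IsSTT T) :
    ∑ j, ∑ i, T i j * S.d j (S.star (S.grad (S.lin a)) i) = 0 := by
  -- The field is ξ = a × x. Its derivative is a constant antisymmetric matrix, annihilated by the
  -- symmetry of T, minus ξ_i x_j, annihilated by tangentiality.
  have hξ : S.star (S.grad (S.lin a)) = ![
      S.x 2 * algebraMap ℝ A (a 1) - S.x 1 * algebraMap ℝ A (a 2),
      S.x 0 * algebraMap ℝ A (a 2) - S.x 2 * algebraMap ℝ A (a 0),
      S.x 1 * algebraMap ℝ A (a 0) - S.x 0 * algebraMap ℝ A (a 1)] := by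
    funext i
    fin_cases i <;> simp [star, grad, E, Fin.sum_univ_three, d_lin] <;> ring
  have t0 := hT.tang 0
  have t1 := hT.tang 1
  have t2 := hT.tang 2
  have s10 := hT.symm 1 0
  have s20 := hT.symm 2 0
  have s21 := hT.symm 2 1
  simp only [Fin.sum_univ_three] at t0 t1 t2
  rw [hξ]
  simp [Fin.sum_univ_three, S.d_x]
  linear_combination (algebraMap ℝ A (a 0) * s21 - algebraMap ℝ A (a 1) * s20
    + algebraMap ℝ A (a 2) * s10)
    - (S.x 2 * algebraMap ℝ A (a 1) - S.x 1 * algebraMap ℝ A (a 2)) * t0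
    - (S.x 0 * algebraMap ℝ A (a 2) - S.x 2 * algebraMap ℝ A (a 0)) * t1
    - (S.x 1 * algebraMap ℝ A (a 0) - S.x 0 * algebraMap ℝ A (a 1)) * t2

/-- The derivative along the rotation field of `n`. -/
def rotD (n f : A) : A := ∑ i, S.star (S.grad n) i * S.d i f

/-- For a Killing field ξ the one-form T(ξ, ·) has divergence (div T)·ξ, so integration by parts
produces no derivative of ξ. -/
lemma integral_killing (a : Fin 3 → ℝ) {T : Fin 3 → Fin 3 → A} (hT : S.IsSTT T) (f : A) :
    S.integral (∑ i, ∑ j, T i j * S.d j f * S.star (S.grad (S.lin a)) i)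
      = -S.integral (f * ∑ i, S.divT T i * S.star (S.grad (S.lin a)) i) := by
  have hw : S.Tang fun j => ∑ i, T i j * S.star (S.grad (S.lin a)) i := by
    have h : ∀ j, T j 0 * S.x 0 + T j 1 * S.x 1 + T j 2 * S.x 2 = 0 := fun j => by
      simpa [Fin.sum_univ_three] using hT.tang j
    have h0 := h 0
    have h1 := h 1
    have h2 := h 2
    simp only [Tang, Fin.sum_univ_three]
    linear_combination S.star (S.grad (S.lin a)) 0 * h0 + S.star (S.grad (S.lin a)) 1 * h1
      + S.star (S.grad (S.lin a)) 2 * h2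
  have hdiv : S.div (fun j => ∑ i, T i j * S.star (S.grad (S.lin a)) i)
      = ∑ i, S.divT T i * S.star (S.grad (S.lin a)) i := by
    have hk := S.killing a hT
    simp only [div, divT, Fin.sum_univ_three, map_add, Derivation.leibniz, smul_eq_mul] at hk ⊢
    linear_combination hk
  have := S.integral_mul_div f hw
  rw [hdiv] at this
  rw [this, neg_neg]
  congr 1
  simp only [Fin.sum_univ_three]
  ring

/-- The integrand is half the derivative of f² along the divergence free field ⋆∇n. -/
lemma integral_rotD_self (n f : A) : S.integral (f * S.rotD n f) = 0 := by
  have h := S.integral_mul_div (f * f) (S.tang_star (S.grad n))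
  rw [div_star_grad, mul_zero, map_zero] at h
  have h2 : ∑ i, S.d i (f * f) * S.star (S.grad n) i = f * S.rotD n f + f * S.rotD n f := by
    simp only [rotD, Fin.sum_univ_three, Derivation.leibniz, smul_eq_mul]
    ring
  rw [h2, map_add] at h
  linarith

lemma star_dot_star {v w : Fin 3 → A} (hv : S.Tang v) :
    ∑ i, S.star v i * S.star w i = ∑ i, v i * w i := by
  have h0 := S.x_sq
  have h1 : v 0 * S.x 0 + v 1 * S.x 1 + v 2 * S.x 2 = 0 := by
    simpa [Tang, Fin.sum_univ_three] using hv
  simp [star, E, Fin.sum_univ_three]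
  linear_combination (v 0 * w 0 + v 1 * w 1 + v 2 * w 2) * h0
    - (w 0 * S.x 0 + w 1 * S.x 1 + w 2 * S.x 2) * h1

lemma star_dot (v w : Fin 3 → A) : ∑ i, S.star v i * w i = -∑ i, v i * S.star w i := by
  simp [star, E, Fin.sum_univ_three]
  ring

/-- The right-hand side of the decomposition of the shear. -/
def shearPair (b c : A) (i j : Fin 3) : A := S.shear c i j + S.starT (S.shear b) i j

lemma isSTT_shearPair (b c : A) : S.IsSTT (S.shearPair b c) :=
  (S.isSTT_shear c).add (S.isSTT_shear b).starT

lemma divT_shearPair (b c : A) (i : Fin 3) :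
    S.divT (S.shearPair b c) i
      = S.grad (S.lap c + 2 * c) i + S.star (S.grad (S.lap b + 2 * b)) i := by
  have h : S.divT (S.shearPair b c) i
      = S.divT (S.shear c) i + S.divT (S.starT (S.shear b)) i := by
    simp [divT, shearPair, Finset.sum_add_distrib]
  rw [h, divT_shear, S.divT_starT (S.isSTT_shear b)]
  simp only [star, divT_shear, grad]

lemma div_add (v w : Fin 3 → A) : S.div (fun i => v i + w i) = S.div v + S.div w := by
  simp [div, Finset.sum_add_distrib]

lemma div_divT_shearPair (b c : A) :
    S.div (S.divT (S.shearPair b c)) = S.lap (S.lap c + 2 * c) := by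
  rw [funext (S.divT_shearPair b c), div_add, div_star_grad, add_zero, div_grad]

lemma div_star_divT_shearPair (b c : A) :
    S.div (S.star (S.divT (S.shearPair b c))) = -S.lap (S.lap b + 2 * b) := by
  have h : ∀ i, S.star (S.divT (S.shearPair b c)) i
      = S.star (S.grad (S.lap c + 2 * c)) i + -S.grad (S.lap b + 2 * b) i := fun i => by
    rw [funext (S.divT_shearPair b c), star_add, S.star_star (S.tang_grad _)]
  rw [funext h, div_add]
  have h2 := S.div_star_grad (S.lap c + 2 * c)
  simp only [div, grad, lap, map_neg, Finset.sum_neg_distrib] at h2 ⊢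
  rw [h2, zero_add]

/-- `χ_{AB} χ^{BC}_{||C}` contracted with the rotation field of `n`. -/
def quadRot (T : Fin 3 → Fin 3 → A) (n : A) : A :=
  ∑ i, (∑ j, T i j * S.divT T j) * S.star (S.grad n) i

/-- With ξ = ⋆∇n the integrand is T(∇C, ξ) - (⋆T)(∇B, ξ). The Killing identity moves the derivatives
from C and B onto T and ⋆T, whose divergences paired with ξ are ξ(C) + ∇n·∇B and ∇n·∇C - ξ(B). The
integrals of C ξ(C) and B ξ(B) vanish, and only mixed terms remain. -/
lemma integral_quadRot_eq_gdot (a : Fin 3 → ℝ) (b c : A) :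
    S.integral (S.quadRot (S.shearPair b c) (S.lin a))
      = S.integral ((S.lap b + 2 * b) * S.gdot (S.lin a) (S.lap c + 2 * c))
        - S.integral ((S.lap c + 2 * c) * S.gdot (S.lin a) (S.lap b + 2 * b)) := by
  set B := S.lap b + 2 * b with hB
  set C := S.lap c + 2 * c with hC
  set T := S.shearPair b c with hTdef
  set n := S.lin a with hn
  have hT : S.IsSTT T := S.isSTT_shearPair b c
  have hV : ∀ i, S.divT T i = S.grad C i + S.star (S.grad B) i := S.divT_shearPair b c
  have e1 : S.quadRot T n = (∑ i, ∑ j, T i j * S.d j C * S.star (S.grad n) i)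
      - ∑ i, ∑ j, S.starT T i j * S.d j B * S.star (S.grad n) i := by
    have hs : ∀ i, ∑ j, T i j * S.star (S.grad B) j = -∑ j, S.starT T i j * S.d j B := by
      intro i
      simp only [hT.starT.symm i]
      simp only [SphereCalculus.starT, star, grad, hT.symm i]
      simp [Fin.sum_univ_three, E]
      ring
    simp only [quadRot, hV, mul_add, Finset.sum_add_distrib, hs, grad]
    simp only [Fin.sum_univ_three]
    ring
  rw [e1, map_sub, S.integral_killing a hT, S.integral_killing a hT.starT]
  have e2 : ∑ i, S.divT T i * S.star (S.grad n) i = S.rotD n C + S.gdot n B := by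
    have h1 := S.star_dot_star (w := S.grad B) (S.tang_grad n)
    simp only [hV, rotD, gdot, grad, Fin.sum_univ_three] at h1 ⊢
    linear_combination h1
  have e3 : ∑ i, S.divT (S.starT T) i * S.star (S.grad n) i = S.gdot n C - S.rotD n B := by
    have h1 := S.star_dot_star (w := S.divT T) (S.tang_grad n)
    have h2 := S.star_dot (S.grad n) (S.grad B)
    simp only [S.divT_starT hT]
    simp only [hV, rotD, gdot, grad, Fin.sum_univ_three] at h1 h2 ⊢
    linear_combination h1 + h2
  rw [← hn, e2, e3, mul_add, mul_sub, map_add, map_sub, S.integral_rotD_self,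
    S.integral_rotD_self]
  ring

/-- Green's formula for n and fg, using D²n = -2n. -/
lemma integral_gdot_lin (a : Fin 3 → ℝ) (f g : A) :
    S.integral (f * S.gdot (S.lin a) g) + S.integral (g * S.gdot (S.lin a) f)
      = 2 * S.integral (S.lin a * (f * g)) := by
  have h := S.integral_mul_lap (f * g) (S.lin a)
  have e1 : S.gdot (f * g) (S.lin a) = f * S.gdot (S.lin a) g + g * S.gdot (S.lin a) f := by
    simp only [gdot, Fin.sum_univ_three, Derivation.leibniz, smul_eq_mul]
    ring
  have e2 : f * g * S.lap (S.lin a) = (-2 : ℝ) • (S.lin a * (f * g)) := by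
    rw [lap_lin, Algebra.smul_def, map_neg, map_ofNat]
    ring
  rw [e1, e2, map_smul, map_add, smul_eq_mul] at h
  linarith

/-- The integral of the quadratic term of the angular momentum in terms of the potentials. -/
lemma integral_quadRot (a : Fin 3 → ℝ) (b c : A) :
    S.integral (S.quadRot (S.shearPair b c) (S.lin a))
      = -2 * S.integral (S.lap b * (S.lin a * S.lap c - S.gdot (S.lin a) (S.lap c)
          - 4 * S.gdot (S.lin a) c)) := by
  rw [integral_quadRot_eq_gdot]
  set n := S.lin a with hn
  have h1 := S.integral_gdot_lin a (S.lap b + 2 * b) (S.lap c + 2 * c)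
  rw [← hn] at h1
  -- This combination is a Laplacian because n is an eigenfunction and ∇n is a conformal field
  -- (`lap_gdot_lin`).
  have e1 : n * (S.lap c + 2 * c) - S.gdot n (S.lap c + 2 * c)
      = -S.lap (n * c + S.gdot n c) := by
    have hg : S.gdot n (S.lap c + 2 * c) = S.gdot n (S.lap c) + 2 * S.gdot n c := by
      simp only [gdot, Fin.sum_univ_three, map_add, d_two_mul]
      ring
    rw [lap_add, lap_mul, hn, lap_gdot_lin, lap_lin, ← hn, hg]
    ring
  have h2 : S.integral (n * ((S.lap b + 2 * b) * (S.lap c + 2 * c)))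
      - S.integral ((S.lap b + 2 * b) * S.gdot n (S.lap c + 2 * c))
      = S.integral (S.lap b * (n * S.lap c - S.gdot n (S.lap c) - 4 * S.gdot n c)) := by
    -- Self-adjointness turns the undifferentiated b in B = D²b + 2b into D²b, so that the whole
    -- integrand acquires the factor D²b.
    have h3 := S.integral_lap_comm b (n * c + S.gdot n c)
    have h4 : n * ((S.lap b + 2 * b) * (S.lap c + 2 * c))
        - (S.lap b + 2 * b) * S.gdot n (S.lap c + 2 * c)
        = S.lap b * (n * (S.lap c + 2 * c) - S.gdot n (S.lap c + 2 * c))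
          - (2 : ℝ) • (b * S.lap (n * c + S.gdot n c)) := by
      rw [Algebra.smul_def, map_ofNat]
      linear_combination (2 * b) * e1
    have hg : S.gdot n (S.lap c + 2 * c) = S.gdot n (S.lap c) + 2 * S.gdot n c := by
      simp only [gdot, Fin.sum_univ_three, map_add, d_two_mul]
      ring
    rw [← map_sub, h4, map_sub, map_smul, h3, ← map_smul, ← map_sub]
    congr 1
    rw [Algebra.smul_def, map_ofNat, hg]
    ring
  linarith

/-! #### Divergences are orthogonal to the low modes -/

lemma integral_div_divT {T : Fin 3 → Fin 3 → A} (hT : S.IsSTT T) :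
    S.integral (S.div (S.divT T)) = 0 :=
  S.integral_div hT.tang_divT

/-- One integration by parts leaves the integral of the k-th component of div T, which is itself the
divergence of the tangential row k. -/
lemma integral_div_divT_mul_x {T : Fin 3 → Fin 3 → A} (hT : S.IsSTT T) (k : Fin 3) :
    S.integral (S.div (S.divT T) * S.x k) = 0 := by
  have t := hT.tang_divT
  have h1 := S.integral_mul_div (S.x k) t
  have h2 : ∑ i, S.d i (S.x k) * S.divT T i = S.div (T k) := by
    simp only [Tang, Fin.sum_univ_three] at t
    simp only [S.d_x, Fin.sum_univ_three]
    fin_cases k <;> simp [div, divT, Fin.sum_univ_three] at t ⊢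
    · linear_combination -S.x 0 * t
    · linear_combination -S.x 1 * t
    · linear_combination -S.x 2 * t
  rw [h2, S.integral_div (hT.tang_row k)] at h1
  rw [mul_comm, h1, neg_zero]

lemma eq_of_div_eq {T T' : Fin 3 → Fin 3 → A} (hT : S.IsSTT T) (hT' : S.IsSTT T')
    (h1 : S.div (S.divT T) = S.div (S.divT T'))
    (h2 : S.div (S.star (S.divT T)) = S.div (S.star (S.divT T'))) : T = T' := by
  have hD := hT.sub hT'
  have hd : ∀ i, S.divT (fun i j => T i j - T' i j) i = S.divT T i - S.divT T' i := fun i => by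
    simp [divT, Finset.sum_sub_distrib]
  have hz : ∀ i, S.divT (fun i j => T i j - T' i j) i = 0 := by
    apply S.eq_zero_of_div_eq_zero hD.tang_divT
    · simp only [div] at h1 ⊢
      simp only [hd, map_sub, Finset.sum_sub_distrib, h1, sub_self]
    · simp only [div_star] at h2 ⊢
      simp only [hd, map_sub]
      linear_combination h2
  funext i j
  exact sub_eq_zero.1 (S.eq_zero_of_divT_eq_zero hD hz i j)

/-! #### Integrals of low modes -/

lemma integral_x (k : Fin 3) : S.integral (S.x k) = 0 := by
  have h := S.integral_d k 1
  rw [Derivation.map_one_eq_zero, map_zero, mul_one] at h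
  linarith

lemma integral_x_mul_x (i k : Fin 3) :
    3 * S.integral (S.x i * S.x k) = if i = k then S.integral 1 else 0 := by
  have h := S.integral_d k (S.x i)
  rw [S.d_x, map_sub, mul_comm (S.x k)] at h
  split_ifs at h ⊢
  · linarith
  · rw [map_zero] at h
    linarith

/-! #### The fundamental solution -/

/-- The fourth-order operator `D²(D² + 2)`. -/
def bilap (f : A) : A := S.lap (S.lap f + 2 * f)

lemma integral_bilap_comm (f g : A) : S.integral (f * S.bilap g) = S.integral (g * S.bilap f) := by
  have h2 : ∀ u v : A, S.integral (u * (2 * v)) = 2 * S.integral (u * v) := fun u v => by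
    rw [show u * (2 * v) = (2 : ℝ) • (u * v) by rw [Algebra.smul_def, map_ofNat]; ring, map_smul,
      smul_eq_mul]
  simp only [bilap, lap_add, lap_two_mul, mul_add, map_add, h2]
  rw [S.integral_lap_comm f (S.lap g), S.integral_lap_comm f g, S.integral_lap_comm g (S.lap f),
    mul_comm (S.lap g)]

lemma bilap_sub (f g : A) : S.bilap (f - g) = S.bilap f - S.bilap g := by
  simp only [bilap, lap_sub, mul_sub, lap_add]
  ring

lemma bilap_smul (r : ℝ) (f : A) : S.bilap (r • f) = r • S.bilap f := by
  simp only [bilap, lap_smul, lap_add, lap_two_mul, smul_add, mul_smul_comm]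

lemma bilap_neg (f : A) : S.bilap (-f) = -S.bilap f := by
  simp only [bilap, lap_neg, lap_add, lap_two_mul, mul_neg]
  ring

lemma bilap_algebraMap (r : ℝ) : S.bilap (algebraMap ℝ A r) = 0 := by
  simp only [bilap, lap_algebraMap, lap_add, lap_two_mul, mul_zero, add_zero]
  simp [lap]

lemma bilap_lin (a : Fin 3 → ℝ) : S.bilap (S.lin a) = 0 := by
  rw [bilap, lap_lin, neg_mul, neg_add_cancel]
  simp [lap]

/-- The chain rule in algebraic form, with v as the derivative of f with respect to w. Logarithm and
inverse thus enter `bilap_mul_log` only through first-order relations. -/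
lemma lap_of_d_eq {f v w : A} (hf : ∀ k, S.d k f = v * S.d k w) :
    S.lap f = v * S.lap w + S.gdot v w := by
  simp only [lap_eq, hf, gdot, Fin.sum_univ_three, Derivation.leibniz, smul_eq_mul]
  ring

/-- `D²(D² + 2)` applied to `w log w`, where `w = κ - n` and `n` is a unit linear form. -/
lemma bilap_mul_log {a : Fin 3 → ℝ} (ha : ∑ i, a i ^ 2 = 1) (κ : ℝ) {w v l : A}
    (hw : w = algebraMap ℝ A κ - S.lin a) (hv : w * v = 1) (hl : ∀ k, S.d k l = v * S.d k w) :
    S.bilap (w * l) = algebraMap ℝ A (2 * (κ ^ 2 - 1) ^ 2) * v ^ 3 - algebraMap ℝ A (2 * κ)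
      - 6 * S.lin a := by
  have hdw : ∀ k, S.d k w = -S.d k (S.lin a) := fun k => by
    rw [hw, map_sub, d_algebraMap, zero_sub]
  have hdv : ∀ k, S.d k v = -(v * v) * S.d k w := fun k => by
    have h := congrArg (S.d k) hv
    simp only [Derivation.leibniz, smul_eq_mul, Derivation.map_one_eq_zero] at h
    linear_combination v * h - S.d k v * hv
  have hlw : S.lap w = 2 * S.lin a := by
    rw [hw, lap_sub, lap_algebraMap, lap_lin]; ring
  set n := S.lin a with hn
  set K := algebraMap ℝ A κ with hK
  have hnn : S.gdot n n = 1 - n * n := by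
    have ha' : algebraMap ℝ A (a 0) ^ 2 + algebraMap ℝ A (a 1) ^ 2 + algebraMap ℝ A (a 2) ^ 2
        = 1 := by
      rw [← map_pow, ← map_pow, ← map_pow, ← map_add, ← map_add, ← map_one (algebraMap ℝ A), ← ha,
        Fin.sum_univ_three]
    rw [hn, gdot_lin]
    simp only [Fin.sum_univ_three, d_lin]
    rw [← hn]
    have hn3 : n = algebraMap ℝ A (a 0) * S.x 0 + algebraMap ℝ A (a 1) * S.x 1
        + algebraMap ℝ A (a 2) * S.x 2 := by rw [hn, lin, Fin.sum_univ_three]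
    linear_combination ha' + n * hn3
  have hww : S.gdot w w = 1 - n * n := by
    rw [← hnn]
    simp only [gdot, hdw, neg_mul_neg]
  have hvw : S.gdot v w = -(v * v) * (1 - n * n) := by
    rw [← hww]
    simp only [gdot, hdv, mul_assoc, ← Finset.mul_sum]
  have hwl : S.gdot w l = v * (1 - n * n) := by
    rw [← hww]
    simp only [gdot, hl, Finset.mul_sum]
    exact Finset.sum_congr rfl fun i _ => by ring
  have hll : S.lap l = v * (2 * n) + -(v * v) * (1 - n * n) := by
    rw [S.lap_of_d_eq hl, hlw, hvw]
  have hlv : S.lap v = -(v * v) * (2 * n) + 2 * v * (v * v) * (1 - n * n) := by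
    rw [S.lap_of_d_eq hdv, hlw]
    have : S.gdot (-(v * v)) w = -(2 * v) * S.gdot v w := by
      simp only [gdot, map_neg, Derivation.leibniz, smul_eq_mul, Fin.sum_univ_three]
      ring
    rw [this, hvw]
    ring
  have hnw : n = K - w := by rw [hw]; ring
  have hKc : ∀ (r : ℝ) (g : A), S.lap (algebraMap ℝ A r * g) = algebraMap ℝ A r * S.lap g := by
    intro r g
    rw [← Algebra.smul_def, lap_smul, Algebra.smul_def]
  -- The shift D² + 2 cancels the terms n log w coming from the l = 1 part of w; the logarithm
  -- survives only with the constant factor 2κ.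
  have h1 : S.lap (w * l) + 2 * (w * l) = algebraMap ℝ A (2 * κ) * l
      - algebraMap ℝ A (κ ^ 2 - 1) * v + algebraMap ℝ A (4 * κ) - algebraMap ℝ A 3 * w := by
    rw [lap_mul, hll, hlw, hwl]
    simp only [map_mul, map_sub, map_pow, map_one, map_ofNat, ← hK]
    rw [hnw]
    linear_combination
      (2 * (K - w) - v * (1 - (K - w) * (K - w)) + (2 * K - w)) * hv
  rw [bilap, h1, lap_sub, lap_add, lap_sub, hKc, hKc, hKc, lap_algebraMap, hll, hlv, hlw]
  simp only [map_mul, map_sub, map_pow, map_one, map_ofNat, ← hK]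
  rw [hnw]
  linear_combination (-4 * K - 4 * K ^ 2 * v + 2 * K * (w * v + 1) - 2 * (K ^ 2 - 1) * v
    - 4 * K * (K ^ 2 - 1) * v ^ 2 + 2 * (K ^ 2 - 1) * v * (w * v + 1)) * hv

end SphereCalculus

/-! ### The calculus of smooth functions on the sphere -/

/-- The algebra of smooth functions on the sphere. -/
abbrev Fn : Type := ContMDiffMap (𝓡 2) 𝓘(ℝ, ℝ) S2 ℝ ∞

lemma Fn.smooth (f : Fn) : Smooth f := f.contMDiff

lemma Fn.continuous (f : Fn) : Continuous f := f.smooth.continuous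

lemma Fn.integrable (f : Fn) : Integrable f area := integrable_of_continuous f.continuous

/-- The tangential derivative as a derivation of the algebra of smooth functions. -/
def tderiv (k : Fin 3) : Derivation ℝ Fn Fn where
  toFun f := ⟨tder k f, f.smooth.tder k⟩
  map_add' f g := ContMDiffMap.ext fun p => tder_add f.smooth g.smooth k p
  map_smul' r f := by
    refine ContMDiffMap.ext fun p => ?_
    have h := tder_mul (f := fun _ => r) (g := f) contMDiff_const f.smooth k p
    rw [tder_const, mul_zero, add_zero] at h
    exact h
  map_one_eq_zero' := ContMDiffMap.ext fun p => tder_const k 1 p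
  leibniz' f g := ContMDiffMap.ext fun p => tder_mul f.smooth g.smooth k p

/-- The Cartesian coordinates as smooth functions on the sphere. -/
def coord (i : Fin 3) : Fn := ⟨fun p => (p : E3) i, smooth_coord i⟩

/-- Integration of smooth functions. -/
def areaIntegral : Fn →ₗ[ℝ] ℝ where
  toFun f := ∫ p, f p ∂area
  map_add' f g := integral_add f.integrable g.integrable
  map_smul' r _ := integral_const_mul r _

lemma coe_tderiv (k : Fin 3) (f : Fn) (p : S2) : tderiv k f p = tder k f p := rfl

lemma areaIntegral_apply (f : Fn) : areaIntegral f = ∫ p, f p ∂area := rfl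

lemma coe_sum {ι : Type*} (s : Finset ι) (f : ι → Fn) (p : S2) :
    (∑ i ∈ s, f i) p = ∑ i ∈ s, f i p :=
  map_sum (ContMDiffMap.evalRingHom p) f s

lemma areaIntegral_rotation (f : Fn) (j k : Fin 3) :
    areaIntegral (coord j * tderiv k f - coord k * tderiv j f) = 0 := by
  by_cases h : j = k
  · rw [h, sub_self, map_zero]
  · exact integral_rotation f.smooth h

/-- The calculus of smooth functions on the unit sphere. -/
def sphereCalculus : SphereCalculus Fn where
  d := tderiv
  x := coord
  integral := areaIntegral
  sum_x_mul_x := ContMDiffMap.ext fun p => by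
    rw [coe_sum]
    exact sum_coord_sq p
  sum_x_mul_d f := ContMDiffMap.ext fun p => by
    rw [coe_sum]
    exact sum_coord_mul_tder f.smooth p
  d_x k i := ContMDiffMap.ext fun p => by
    rw [coe_tderiv]
    refine (tder_coord i k p).trans ?_
    split_ifs <;> rfl
  d_d j k f := ContMDiffMap.ext fun p => by
    have := tder_comm f.smooth j k p
    change tder j (tder k f) p = tder k (tder j f) p + (p : E3) j * tder k f p
      - (p : E3) k * tder j f p
    linarith
  integral_d k f := by
    have hx : coord 0 * coord 0 + coord 1 * coord 1 + coord 2 * coord 2 = 1 :=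
      ContMDiffMap.ext fun p => by
        have := sum_coord_sq p
        rwa [Fin.sum_univ_three] at this
    have hd : coord 0 * tderiv 0 f + coord 1 * tderiv 1 f + coord 2 * tderiv 2 f = 0 :=
      ContMDiffMap.ext fun p => by
        have := sum_coord_mul_tder f.smooth p
        rwa [Fin.sum_univ_three] at this
    have hdx : ∀ k i, tderiv k (coord i) = (if i = k then 1 else 0) - coord i * coord k :=
      fun k i => ContMDiffMap.ext fun p => by
        rw [coe_tderiv]
        refine (tder_coord i k p).trans ?_
        split_ifs <;> rfl
    have h : tderiv k f = (coord 0 * tderiv k (coord 0 * f) - coord k * tderiv 0 (coord 0 * f))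
        + (coord 1 * tderiv k (coord 1 * f) - coord k * tderiv 1 (coord 1 * f))
        + (coord 2 * tderiv k (coord 2 * f) - coord k * tderiv 2 (coord 2 * f))
        + (2 : ℝ) • (coord k * f) := by
      rw [Algebra.smul_def, map_ofNat]
      simp only [Derivation.leibniz, smul_eq_mul, hdx, if_true]
      fin_cases k <;> simp
      · linear_combination (-tderiv 0 f) * hx + coord 0 * hd
      · linear_combination (-tderiv 1 f) * hx + coord 1 * hd
      · linear_combination (-tderiv 2 f) * hx + coord 2 * hd
    conv_lhs => rw [h]
    rw [map_add, map_add, map_add, areaIntegral_rotation, areaIntegral_rotation,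
      areaIntegral_rotation, map_smul, smul_eq_mul, zero_add, zero_add, zero_add]
  integral_mul_self_nonneg f := integral_nonneg fun p => mul_self_nonneg (f p)
  eq_zero_of_integral_mul_self f hf := by
    refine ContMDiffMap.ext fun p => ?_
    have h1 : (fun p => f p * f p) =ᵐ[area] 0 :=
      (integral_eq_zero_iff_of_nonneg (fun p => mul_self_nonneg (f p)) (f * f).integrable).1 hf
    have h2 : (fun p => f p * f p) = 0 :=
      (Continuous.ae_eq_iff_eq area (f.continuous.mul f.continuous) continuous_const).1 h1
    exact mul_self_eq_zero.1 (congrFun h2 p)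

/-! ### The fundamental solution of `D²(D² + 2)` -/

local notation "𝒮" => sphereCalculus

lemma coe_lin (a : Fin 3 → ℝ) (p : S2) : SphereCalculus.lin 𝒮 a p = ∑ i, a i * (p : E3) i := by
  rw [SphereCalculus.lin, coe_sum]
  rfl

lemma coe_lin_coe (q p : S2) :
    SphereCalculus.lin 𝒮 (fun i => (q : E3) i) p = inner ℝ (q : E3) (p : E3) := by
  rw [coe_lin]
  simp [PiLp.inner_apply, mul_comm]

lemma inner_le_one (q p : S2) : inner ℝ (q : E3) (p : E3) ≤ 1 := by
  have := real_inner_le_norm (q : E3) (p : E3)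
  simpa using this

lemma areaIntegral_one_pos : 0 < areaIntegral 1 := by
  refine lt_of_le_of_ne ?_ fun h => ?_
  · have := sphereCalculus.integral_mul_self_nonneg 1
    rwa [mul_one] at this
  · have := sphereCalculus.eq_zero_of_integral_mul_self 1 (by rw [mul_one]; exact h.symm)
    have h2 := congrArg (fun f : Fn => f ⟨EuclideanSpace.single 0 1, by simp⟩) this
    exact one_ne_zero h2

/-- `κ - ⟨q, ·⟩`. -/
def shifted (κ : ℝ) (q : S2) : Fn :=
  algebraMap ℝ Fn κ - SphereCalculus.lin 𝒮 (fun i => (q : E3) i)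

lemma shifted_apply (κ : ℝ) (q p : S2) : shifted κ q p = κ - inner ℝ (q : E3) (p : E3) := by
  rw [← coe_lin_coe]
  rfl

lemma shifted_pos {κ : ℝ} (hκ : 1 < κ) (q p : S2) : 0 < shifted κ q p := by
  rw [shifted_apply]
  linarith [inner_le_one q p]

lemma smooth_comp {f : S2 → ℝ} (hf : Smooth f) {φ : ℝ → ℝ}
    (hφ : ∀ p, ContDiffAt ℝ ∞ φ (f p)) : Smooth fun p => φ (f p) := fun p =>
  (hφ p).contMDiffAt.comp p (hf p)

/-- `(κ - ⟨q, ·⟩)⁻¹`. -/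
def shiftedInv {κ : ℝ} (hκ : 1 < κ) (q : S2) : Fn :=
  ⟨fun p => (shifted κ q p)⁻¹, smooth_comp (shifted κ q).smooth fun p =>
    contDiffAt_inv ℝ (shifted_pos hκ q p).ne'⟩

/-- `log (κ - ⟨q, ·⟩)`. -/
def shiftedLog {κ : ℝ} (hκ : 1 < κ) (q : S2) : Fn :=
  ⟨fun p => Real.log (shifted κ q p), smooth_comp (shifted κ q).smooth fun p =>
    Real.contDiffAt_log.2 (shifted_pos hκ q p).ne'⟩

lemma bilap_shifted_mul_log {κ : ℝ} (hκ : 1 < κ) (q : S2) :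
    SphereCalculus.bilap 𝒮 (shifted κ q * shiftedLog hκ q)
      = algebraMap ℝ Fn (2 * (κ ^ 2 - 1) ^ 2) * shiftedInv hκ q ^ 3 - algebraMap ℝ Fn (2 * κ)
        - 6 * SphereCalculus.lin 𝒮 (fun i => (q : E3) i) := by
  refine SphereCalculus.bilap_mul_log 𝒮 ?_ κ rfl ?_ ?_
  · simpa [sq] using sum_coord_sq q
  · exact ContMDiffMap.ext fun p => mul_inv_cancel₀ (shifted_pos hκ q p).ne'
  · intro k
    refine ContMDiffMap.ext fun p => ?_
    exact tder_comp (shifted κ q).smooth (Real.hasDerivAt_log (shifted_pos hκ q p).ne') k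

/-- The peak function `2 (κ² - 1)² / (κ - ⟨q, ·⟩)³`. -/
def peak (κ : ℝ) (q p : S2) : ℝ := 2 * (κ ^ 2 - 1) ^ 2 * ((κ - inner ℝ (q : E3) (p : E3))⁻¹) ^ 3

lemma peak_nonneg {κ : ℝ} (hκ : 1 < κ) (q p : S2) : 0 ≤ peak κ q p := by
  have := (shifted_pos hκ q p).le
  rw [shifted_apply] at this
  rw [peak]
  positivity

lemma continuous_peak {κ : ℝ} (hκ : 1 < κ) (q : S2) : Continuous (peak κ q) := by
  have h : peak κ q = fun p => 2 * (κ ^ 2 - 1) ^ 2 * (shiftedInv hκ q p) ^ 3 := by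
    funext p
    rw [peak, ← shifted_apply]
    rfl
  rw [h]
  exact continuous_const.mul ((shiftedInv hκ q).continuous.pow 3)

lemma integral_mul_log_mul_bilap {κ : ℝ} (hκ : 1 < κ) (q : S2) (f : Fn) :
    ∫ p, (κ - inner ℝ (q : E3) (p : E3)) * Real.log (κ - inner ℝ (q : E3) (p : E3))
        * SphereCalculus.bilap 𝒮 f p ∂area
      = (∫ p, peak κ q p * f p ∂area) - 2 * κ * areaIntegral f
        - 6 * areaIntegral (SphereCalculus.lin 𝒮 (fun i => (q : E3) i) * f) := by
  have h := SphereCalculus.integral_bilap_comm 𝒮 (shifted κ q * shiftedLog hκ q) f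
  rw [bilap_shifted_mul_log] at h
  have e1 : f * (algebraMap ℝ Fn (2 * (κ ^ 2 - 1) ^ 2) * shiftedInv hκ q ^ 3
      - algebraMap ℝ Fn (2 * κ) - 6 * SphereCalculus.lin 𝒮 (fun i => (q : E3) i))
      = (2 * (κ ^ 2 - 1) ^ 2) • (shiftedInv hκ q ^ 3 * f) - (2 * κ) • f
        - (6 : ℝ) • (SphereCalculus.lin 𝒮 (fun i => (q : E3) i) * f) := by
    simp only [Algebra.smul_def, map_ofNat]
    ring
  rw [e1, map_sub, map_sub, map_smul _ (2 * κ), map_smul _ (6 : ℝ)] at h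
  have e2 : ∀ p, (shifted κ q * shiftedLog hκ q * SphereCalculus.bilap 𝒮 f) p
      = (κ - inner ℝ (q : E3) (p : E3)) * Real.log (κ - inner ℝ (q : E3) (p : E3))
        * SphereCalculus.bilap 𝒮 f p := by
    intro p
    rw [← shifted_apply]
    rfl
  have e3 : ∀ p, ((2 * (κ ^ 2 - 1) ^ 2) • (shiftedInv hκ q ^ 3 * f)) p = peak κ q p * f p := by
    intro p
    rw [peak, ← shifted_apply, mul_assoc]
    rfl
  have e4 := integral_congr_ae (μ := area) (Filter.Eventually.of_forall e2)
  have e5 := integral_congr_ae (μ := area) (Filter.Eventually.of_forall e3)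
  rw [← e4, ← e5]
  exact h

/-- The total mass is read off by testing with f = 1, which D²(D² + 2) annihilates. -/
lemma integral_peak {κ : ℝ} (hκ : 1 < κ) (q : S2) :
    ∫ p, peak κ q p ∂area = 2 * κ * areaIntegral 1 := by
  have h := integral_mul_log_mul_bilap hκ q 1
  have h0 : SphereCalculus.bilap 𝒮 (1 : Fn) = 0 := by
    have := SphereCalculus.bilap_algebraMap 𝒮 1
    rwa [map_one] at this
  have h1 : areaIntegral (SphereCalculus.lin 𝒮 (fun i => (q : E3) i) * 1) = 0 := by
    rw [mul_one, SphereCalculus.lin, map_sum]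
    refine Finset.sum_eq_zero fun i _ => ?_
    rw [← Algebra.smul_def, map_smul]
    have := SphereCalculus.integral_x 𝒮 i
    change (q : E3) i • (SphereCalculus.integral 𝒮 (SphereCalculus.x 𝒮 i)) = 0
    rw [this, smul_zero]
  rw [h0, h1] at h
  simp only [ContMDiffMap.coe_zero, Pi.zero_apply, mul_zero, integral_zero,
    ContMDiffMap.coe_one, Pi.one_apply, mul_one, sub_zero] at h
  linarith

open Filter Topology in
-- Divided by twice the total area, the peaks form an approximate identity at q: they are
-- nonnegative, their mass tends to 1, and the factor (κ² - 1)² makes them vanish uniformly away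
-- from q.
lemma tendsto_integral_peak (q : S2) (f : Fn) :
    Tendsto (fun κ => ∫ p, peak κ q p * f p ∂area) (𝓝[>] 1) (𝓝 (2 * areaIntegral 1 * f q)) := by
  have hV := areaIntegral_one_pos
  have hgt : ∀ᶠ κ : ℝ in 𝓝[>] 1, 1 < κ := self_mem_nhdsWithin
  have hk1 : Tendsto (fun κ : ℝ => κ) (𝓝[>] 1) (𝓝 1) :=
    tendsto_nhdsWithin_of_tendsto_nhds tendsto_id
  have key : Tendsto (fun κ => ∫ p, (peak κ q p / (2 * areaIntegral 1)) • f p ∂area) (𝓝[>] 1)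
      (𝓝 (f q)) := by
    refine tendsto_integral_peak_smul_of_integrable_of_tendsto (t := Set.univ) MeasurableSet.univ
      Filter.univ_mem ?_ ?_ ?_ ?_ ?_ f.integrable f.continuous.continuousAt
    · exact measure_ne_top _ _
    · filter_upwards [hgt] with κ hκ p
      exact div_nonneg (peak_nonneg hκ q p) (by positivity)
    · intro u hu hqu
      -- On the unit sphere ⟨q, p⟩ = 1 only for p = q, so by compactness 1 - ⟨q, p⟩ has a positive
      -- lower bound off the neighbourhood.
      obtain ⟨δ, hδ, hδu⟩ := hu.isClosed_compl.isCompact.exists_forall_le' (a := 0)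
        (f := fun p : S2 => 1 - inner ℝ (q : E3) (p : E3))
        (continuous_const.sub (continuous_const.inner continuous_subtype_val)).continuousOn
        (fun p hp => by
          have h1 : inner ℝ (q : E3) (p : E3) ≠ 1 := fun h =>
            hp ((sphere_ext_iff q p).2 h ▸ hqu)
          exact sub_pos.2 (lt_of_le_of_ne (inner_le_one q p) h1))
      have hb : Tendsto (fun κ : ℝ => 2 * (κ ^ 2 - 1) ^ 2 * (δ⁻¹) ^ 3 / (2 * areaIntegral 1))
          (𝓝[>] 1) (𝓝 0) := by
        have hc : Continuous fun κ : ℝ =>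
            2 * (κ ^ 2 - 1) ^ 2 * (δ⁻¹) ^ 3 / (2 * areaIntegral 1) := by fun_prop
        simpa using (hc.tendsto 1).mono_left nhdsWithin_le_nhds
      rw [Metric.tendstoUniformlyOn_iff]
      intro e he
      filter_upwards [hgt, hb.eventually (gt_mem_nhds he)] with κ hκ hκe p hp
      rw [Pi.zero_apply, dist_zero_left, Real.norm_of_nonneg
        (div_nonneg (peak_nonneg hκ q p) (by positivity))]
      refine lt_of_le_of_lt ?_ hκe
      have h1 := hδu p hp
      have h2 : 0 < κ - inner ℝ (q : E3) (p : E3) := by linarith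
      rw [peak]
      gcongr
      linarith
    · simp only [Measure.restrict_univ, integral_div]
      have h1 : Tendsto (fun κ : ℝ => 2 * κ * areaIntegral 1 / (2 * areaIntegral 1)) (𝓝[>] 1)
          (𝓝 1) := by
        have := ((hk1.const_mul 2).mul_const (areaIntegral 1)).div_const (2 * areaIntegral 1)
        rwa [mul_one, div_self (by positivity)] at this
      refine h1.congr' ?_
      filter_upwards [hgt] with κ hκ
      rw [integral_peak hκ]
    · filter_upwards [hgt] with κ hκ
      exact ((continuous_peak hκ q).div_const _).aestronglyMeasurable
  have h2 := key.const_mul (2 * areaIntegral 1)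
  refine h2.congr fun κ => ?_
  rw [← integral_const_mul]
  refine integral_congr_ae (Filter.Eventually.of_forall fun p => ?_)
  simp only [smul_eq_mul]
  field_simp

open Filter Topology in
/-- The representation formula for the fundamental solution of `D²(D² + 2)`. -/
lemma integral_kernel_mul_bilap (q : S2) (f : Fn) :
    ∫ p, (1 - inner ℝ (q : E3) (p : E3)) * Real.log (1 - inner ℝ (q : E3) (p : E3))
        * SphereCalculus.bilap 𝒮 f p ∂area
      = 2 * areaIntegral 1 * f q - 2 * areaIntegral f
        - 6 * areaIntegral (SphereCalculus.lin 𝒮 (fun i => (q : E3) i) * f) := by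
  have hk1 : Tendsto (fun κ : ℝ => κ) (𝓝[>] 1) (𝓝 1) :=
    tendsto_nhdsWithin_of_tendsto_nhds tendsto_id
  -- The limit κ → 1 passes under the integral because t log t, with value 0 at t = 0, is continuous
  -- on the whole line.
  have hcont : Continuous fun κ : ℝ => ∫ p : S2 in Set.univ,
      (κ - inner ℝ (q : E3) (p : E3)) * Real.log (κ - inner ℝ (q : E3) (p : E3))
        * SphereCalculus.bilap 𝒮 f p ∂area := by
    refine continuous_parametric_integral_of_continuous
      (f := fun (κ : ℝ) (p : S2) => (κ - inner ℝ (q : E3) (p : E3))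
        * Real.log (κ - inner ℝ (q : E3) (p : E3)) * SphereCalculus.bilap 𝒮 f p) ?_ isCompact_univ
    have h1 : Continuous fun z : ℝ × S2 => z.1 - inner ℝ (q : E3) (z.2 : E3) :=
      continuous_fst.sub (continuous_const.inner (continuous_subtype_val.comp continuous_snd))
    exact (Real.continuous_mul_log.comp h1).mul ((Fn.continuous _).comp continuous_snd)
  simp only [Measure.restrict_univ] at hcont
  have hL := (hcont.tendsto 1).mono_left (nhdsWithin_le_nhds (s := Set.Ioi 1))
  have hR : Tendsto (fun κ : ℝ => (∫ p, peak κ q p * f p ∂area) - 2 * κ * areaIntegral f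
        - 6 * areaIntegral (SphereCalculus.lin 𝒮 (fun i => (q : E3) i) * f)) (𝓝[>] 1)
      (𝓝 (2 * areaIntegral 1 * f q - 2 * 1 * areaIntegral f
        - 6 * areaIntegral (SphereCalculus.lin 𝒮 (fun i => (q : E3) i) * f))) :=
    ((tendsto_integral_peak q f).sub ((hk1.const_mul 2).mul_const _)).sub_const _
  have hE : (fun κ : ℝ => ∫ p : S2,
      (κ - inner ℝ (q : E3) (p : E3)) * Real.log (κ - inner ℝ (q : E3) (p : E3))
        * SphereCalculus.bilap 𝒮 f p ∂area) =ᶠ[𝓝[>] 1] fun κ : ℝ =>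
        (∫ p, peak κ q p * f p ∂area) - 2 * κ * areaIntegral f
        - 6 * areaIntegral (SphereCalculus.lin 𝒮 (fun i => (q : E3) i) * f) := by
    filter_upwards [self_mem_nhdsWithin] with κ hκ
    exact integral_mul_log_mul_bilap hκ q f
  have := tendsto_nhds_unique (hL.congr' hE) hR
  rw [this]
  ring

/-! ### Solving `D²(D² + 2) u = g` -/

/-- A smooth function without `l = 0, 1` parts. -/
def Fn.NoLow (f : Fn) : Prop := areaIntegral f = 0 ∧ ∀ i, areaIntegral (f * coord i) = 0

lemma areaIntegral_lin_mul (a : Fin 3 → ℝ) (f : Fn) :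
    areaIntegral (SphereCalculus.lin 𝒮 a * f) = ∑ i, a i * areaIntegral (f * coord i) := by
  rw [SphereCalculus.lin, Finset.sum_mul, map_sum]
  refine Finset.sum_congr rfl fun i _ => ?_
  rw [mul_assoc, ← Algebra.smul_def, map_smul, smul_eq_mul, mul_comm _ f]
  rfl

lemma Fn.NoLow.areaIntegral_lin_mul {f : Fn} (hf : f.NoLow) (a : Fin 3 → ℝ) :
    areaIntegral (SphereCalculus.lin 𝒮 a * f) = 0 := by
  rw [NullInfinity.areaIntegral_lin_mul]
  simp [hf.2]

lemma Fn.NoLow.eq_zero_of_bilap {f : Fn} (hf : f.NoLow)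
    (h : SphereCalculus.bilap 𝒮 f = 0) : f = 0 := by
  refine ContMDiffMap.ext fun q => ?_
  have h1 := integral_kernel_mul_bilap q f
  rw [h, hf.1, hf.areaIntegral_lin_mul] at h1
  have hV := areaIntegral_one_pos
  simp only [ContMDiffMap.coe_zero, Pi.zero_apply, mul_zero, integral_zero, sub_zero] at h1
  have h2 : 2 * areaIntegral 1 ≠ 0 := by positivity
  simpa using (mul_eq_zero.1 h1.symm).resolve_left h2

/-- The kernel `(1 - z) log (1 - z)`. -/
def greenKernel (z : ℝ) : ℝ := (1 - z) * Real.log (1 - z)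

lemma continuous_greenKernel : Continuous greenKernel :=
  Real.continuous_mul_log.comp (continuous_const.sub continuous_id)

/-- Convolution with `greenKernel`. -/
def greenConv (g : Fn) : Fn :=
  ⟨fun x => ∫ y : S2, greenKernel (inner ℝ (x : E3) (y : E3)) * g y ∂area,
    smooth_zonal_convolution g.smooth continuous_greenKernel⟩

/-- The weak form of the equation, by Fubini and the symmetry of the kernel. The l = 0, 1 terms of
the representation formula for φ drop out on pairing with g. -/
lemma areaIntegral_greenConv_mul_bilap {g : Fn} (hg : g.NoLow) (φ : Fn) :
    areaIntegral (greenConv g * SphereCalculus.bilap 𝒮 φ)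
      = 2 * areaIntegral 1 * areaIntegral (g * φ) := by
  set B := SphereCalculus.bilap 𝒮 φ with hB
  have hcont : Continuous (Function.uncurry fun (x y : S2) =>
      greenKernel (inner ℝ (x : E3) (y : E3)) * g y * B x) := by
    have h1 : Continuous fun z : S2 × S2 => inner ℝ (z.1 : E3) (z.2 : E3) :=
      (continuous_subtype_val.comp continuous_fst).inner (continuous_subtype_val.comp continuous_snd)
    exact ((continuous_greenKernel.comp h1).mul (g.continuous.comp continuous_snd)).mul
      (B.continuous.comp continuous_fst)
  have hint : Integrable (Function.uncurry fun (x y : S2) =>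
      greenKernel (inner ℝ (x : E3) (y : E3)) * g y * B x) (area.prod area) :=
    hcont.integrable_of_hasCompactSupport (HasCompactSupport.of_compactSpace _)
  have h1 : areaIntegral (greenConv g * B) = ∫ x, ∫ y,
      greenKernel (inner ℝ (x : E3) (y : E3)) * g y * B x ∂area ∂area := by
    refine integral_congr_ae (Filter.Eventually.of_forall fun x => ?_)
    exact (integral_mul_const (B x) _).symm
  rw [h1, integral_integral_swap hint]
  have h2 : ∀ y : S2, ∫ x : S2, greenKernel (inner ℝ (x : E3) (y : E3)) * g y * B x ∂area
      = g y * (2 * areaIntegral 1 * φ y - 2 * areaIntegral φ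
        - 6 * ∑ i, (y : E3) i * areaIntegral (φ * coord i)) := by
    intro y
    have h3 := integral_kernel_mul_bilap y φ
    rw [areaIntegral_lin_mul] at h3
    rw [← h3, ← integral_const_mul]
    refine integral_congr_ae (Filter.Eventually.of_forall fun x => ?_)
    simp only [greenKernel, real_inner_comm, hB]
    ring
  simp only [h2]
  have h4 : ∀ y : S2, g y * (2 * areaIntegral 1 * φ y - 2 * areaIntegral φ
        - 6 * ∑ i, (y : E3) i * areaIntegral (φ * coord i))
      = ((2 * areaIntegral 1) • (g * φ) - (2 * areaIntegral φ) • g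
        - (6 : ℝ) • ∑ i, areaIntegral (φ * coord i) • (g * coord i)) y := by
    intro y
    have h5 : (∑ i, areaIntegral (φ * coord i) • (g * coord i)) y
        = ∑ i, areaIntegral (φ * coord i) * (g y * (y : E3) i) := by
      rw [coe_sum]
      rfl
    change _ = 2 * areaIntegral 1 * (g y * φ y) - 2 * areaIntegral φ * g y
      - 6 * (∑ i, areaIntegral (φ * coord i) • (g * coord i)) y
    rw [h5]
    simp only [Fin.sum_univ_three]
    ring
  simp only [h4]
  rw [← areaIntegral_apply, map_sub, map_sub, map_smul, map_smul, map_smul, map_sum]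
  simp only [map_smul, hg.1, hg.2]
  simp

/-- The convolution is already smooth, so the weak equation can be tested against its own residual
φ, which then has zero square integral. -/
lemma bilap_greenConv {g : Fn} (hg : g.NoLow) :
    SphereCalculus.bilap 𝒮 (greenConv g) = (2 * areaIntegral 1) • g := by
  set V := areaIntegral 1
  refine sub_eq_zero.1 (SphereCalculus.eq_zero_of_integral_mul_self 𝒮 _ ?_)
  set φ := SphereCalculus.bilap 𝒮 (greenConv g) - (2 * V) • g with hφ
  have h1 := SphereCalculus.integral_bilap_comm 𝒮 φ (greenConv g)
  have h2 := areaIntegral_greenConv_mul_bilap hg φ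
  have h3 : φ * φ = φ * SphereCalculus.bilap 𝒮 (greenConv g) - (2 * V) • (g * φ) := by
    conv_lhs => rw [hφ]
    rw [← hφ, sub_mul, smul_mul_assoc, mul_comm φ]
  rw [h3, map_sub, h1, map_smul]
  exact sub_eq_zero.2 h2

lemma areaIntegral_coord_mul_coord (i k : Fin 3) :
    3 * areaIntegral (coord i * coord k) = if i = k then areaIntegral 1 else 0 :=
  SphereCalculus.integral_x_mul_x 𝒮 i k

lemma areaIntegral_coord (i : Fin 3) : areaIntegral (coord i) = 0 :=
  SphereCalculus.integral_x 𝒮 i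

lemma areaIntegral_algebraMap_mul (r : ℝ) (f : Fn) :
    areaIntegral (algebraMap ℝ Fn r * f) = r * areaIntegral f := by
  rw [← Algebra.smul_def, map_smul, smul_eq_mul]

lemma exists_noLow_bilap_eq {g : Fn} (hg : g.NoLow) :
    ∃ u : Fn, u.NoLow ∧ SphereCalculus.bilap 𝒮 u = g := by
  have hV := areaIntegral_one_pos
  set V := areaIntegral 1
  set u := (2 * V)⁻¹ • greenConv g with hu
  have hub : SphereCalculus.bilap 𝒮 u = g := by
    rw [hu, SphereCalculus.bilap_smul, bilap_greenConv hg, smul_smul,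
      inv_mul_cancel₀ (by positivity), one_smul]
  -- Removal of the l = 0, 1 parts, which the operator annihilates. The factor 3/V normalises the
  -- coordinates, since ∫ x_i x_k = δ_ik V/3.
  refine ⟨u - algebraMap ℝ Fn (areaIntegral u / V)
    - SphereCalculus.lin 𝒮 (fun i => 3 * areaIntegral (u * coord i) / V), ⟨?_, fun k => ?_⟩, ?_⟩
  · have h1 := areaIntegral_lin_mul (fun i => 3 * areaIntegral (u * coord i) / V) 1
    have h2 := areaIntegral_algebraMap_mul (areaIntegral u / V) 1
    rw [mul_one] at h1 h2
    rw [map_sub, map_sub, h1, h2]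
    simp only [one_mul, areaIntegral_coord, mul_zero, Finset.sum_const_zero, sub_zero]
    change areaIntegral u - areaIntegral u / V * V = 0
    field_simp
    simp
  · have h1 := areaIntegral_lin_mul (fun i => 3 * areaIntegral (u * coord i) / V) (coord k)
    have h3 : ∀ i, areaIntegral (coord k * coord i) = if k = i then V / 3 else 0 := fun i => by
      have := areaIntegral_coord_mul_coord k i
      split_ifs at this ⊢ <;> linarith
    rw [sub_mul, sub_mul, map_sub, map_sub, h1, areaIntegral_algebraMap_mul, areaIntegral_coord]
    simp only [h3, mul_ite, mul_zero, Finset.sum_ite_eq, Finset.mem_univ, if_true, sub_zero]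
    field_simp
    simp
  · rw [SphereCalculus.bilap_sub, SphereCalculus.bilap_sub, SphereCalculus.bilap_algebraMap,
      SphereCalculus.bilap_lin, hub, sub_zero, sub_zero]

/-! ### Decomposition of symmetric traceless tensors -/

lemma noLow_div_divT {T : Fin 3 → Fin 3 → Fn} (hT : SphereCalculus.IsSTT 𝒮 T) :
    (SphereCalculus.div 𝒮 (SphereCalculus.divT 𝒮 T)).NoLow :=
  ⟨SphereCalculus.integral_div_divT 𝒮 hT, SphereCalculus.integral_div_divT_mul_x 𝒮 hT⟩

lemma Fn.NoLow.neg {f : Fn} (hf : f.NoLow) : (-f).NoLow :=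
  ⟨by rw [map_neg, hf.1, neg_zero], fun i => by rw [neg_mul, map_neg, hf.2, neg_zero]⟩

lemma Fn.NoLow.sub {f g : Fn} (hf : f.NoLow) (hg : g.NoLow) : (f - g).NoLow :=
  ⟨by rw [map_sub, hf.1, hg.1, sub_zero], fun i => by rw [sub_mul, map_sub, hf.2, hg.2, sub_zero]⟩

lemma exists_shearPair_eq {T : Fin 3 → Fin 3 → Fn} (hT : SphereCalculus.IsSTT 𝒮 T) :
    ∃ b c : Fn, b.NoLow ∧ c.NoLow ∧ T = SphereCalculus.shearPair 𝒮 b c := by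
  obtain ⟨c, hc, hcT⟩ := exists_noLow_bilap_eq (noLow_div_divT hT)
  obtain ⟨b, hb, hbT⟩ := exists_noLow_bilap_eq (noLow_div_divT hT.starT)
  -- The sign comes from ⋆⋆ = -1 on tangential one-forms: the curl of the divergence is minus the
  -- fourth-order operator applied to the first potential.
  refine ⟨-b, c, hb.neg, hc, ?_⟩
  refine SphereCalculus.eq_of_div_eq 𝒮 hT (SphereCalculus.isSTT_shearPair 𝒮 _ _) ?_ ?_
  · rw [SphereCalculus.div_divT_shearPair, ← hcT]
    rfl
  · have h1 := SphereCalculus.div_star_divT_shearPair 𝒮 (-b) c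
    change _ = -SphereCalculus.bilap 𝒮 (-b) at h1
    rw [h1, SphereCalculus.bilap_neg, neg_neg, hbT,
      funext (SphereCalculus.divT_starT 𝒮 hT)]

/-! ### Comparison of the tensor calculus with its algebraic form -/

lemma sum_metric_mul (p : S2) (i : Fin 3) (v : Fin 3 → ℝ) :
    ∑ a, metric p i a * v a = v i - (p : E3) i * ∑ a, (p : E3) a * v a := by
  simp only [metric, sub_mul, Finset.sum_sub_distrib, ite_mul, one_mul, zero_mul,
    Finset.sum_ite_eq, Finset.mem_univ, if_true, Finset.mul_sum, mul_assoc]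

lemma sum_coord_mul_tderiv (f : Fn) (p : S2) :
    ∑ i, (p : E3) i * tderiv i f p = 0 := sum_coord_mul_tder f.smooth p

lemma hess_coe (f : Fn) (p : S2) (i j : Fin 3) :
    hess f p i j = (tderiv j (tderiv i f) + coord i * tderiv j f) p := by
  have h : ∑ a, (p : E3) a * tderiv j (tderiv a f) p = -tderiv j f p := by
    have h1 := congrArg (fun g : Fn => g p) (SphereCalculus.x_d_d 𝒮 f j)
    rw [Fin.sum_univ_three]
    exact h1
  refine (sum_metric_mul p i fun a => tderiv j (tderiv a f) p).trans ?_
  rw [h]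
  change _ = tderiv j (tderiv i f) p + (p : E3) i * tderiv j f p
  ring

lemma lap_coe (f : Fn) : lap f = SphereCalculus.lap 𝒮 f := by
  funext p
  have h1 := sum_coord_mul_tderiv f p
  simp only [lap, hess_coe]
  rw [SphereCalculus.lap, coe_sum]
  change ∑ i, (tderiv i (tderiv i f) p + (p : E3) i * tderiv i f p) = _
  rw [Finset.sum_add_distrib, h1, add_zero]
  rfl

lemma gradDot_coe (f g : Fn) (p : S2) : gradDot f g p = SphereCalculus.gdot 𝒮 f g p := by
  rw [SphereCalculus.gdot, coe_sum]
  rfl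

lemma eps_eq (p : S2) (i j : Fin 3) : eps p i j = SphereCalculus.E 𝒮 i j p := by
  have hx : ∀ k, SphereCalculus.x 𝒮 k p = (p : E3) k := fun _ => rfl
  fin_cases i <;> fin_cases j <;>
    simp [eps, SphereCalculus.E, Matrix.det_fin_three, hx]

lemma rot_coe (n : Fn) (p : S2) (i : Fin 3) :
    rot n p i = SphereCalculus.star 𝒮 (SphereCalculus.grad 𝒮 n) i p := by
  rw [SphereCalculus.star, coe_sum]
  simp only [rot, eps_eq]
  rfl

lemma div1_coe (W : Fin 3 → Fn) (p : S2) :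
    div1 (fun q i => W i q) p = SphereCalculus.div 𝒮 W p := by
  have h : ∀ i, covD1 (fun q i => W i q) p i i
      = tderiv i (W i) p - ∑ a, (p : E3) a * ((p : E3) i * tderiv i (W a) p) := fun i => by
    refine (sum_metric_mul p i fun a => tderiv i (W a) p).trans ?_
    rw [Finset.mul_sum]
    congr 1
    exact Finset.sum_congr rfl fun a _ => by ring
  rw [div1, SphereCalculus.div, coe_sum]
  simp only [h, Finset.sum_sub_distrib]
  rw [Finset.sum_comm]
  simp only [← Finset.mul_sum, sum_coord_mul_tderiv, mul_zero, Finset.sum_const_zero, sub_zero]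
  rfl

/-- Both tangential projections in `covD2` disappear: on the contracted index because derivatives
are tangential, on the free index because T is tangential and traceless (`tang_divT`). -/
lemma div2_coe {T : Fin 3 → Fin 3 → Fn} (hT : SphereCalculus.IsSTT 𝒮 T) (p : S2) (i : Fin 3) :
    div2 (fun q i j => T i j q) p i = SphereCalculus.divT 𝒮 T i p := by
  have h1 : div2 (fun q i j => T i j q) p i
      = ∑ a, metric p i a * SphereCalculus.divT 𝒮 T a p := by
    have h2 : ∀ a, ∑ j, ∑ b, metric p j b * tderiv j (T a b) p
        = SphereCalculus.divT 𝒮 T a p := fun a =>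
      div1_coe (T a) p
    simp only [← h2, Finset.mul_sum]
    rw [div2]
    simp only [covD2]
    rw [Finset.sum_comm]
    refine Finset.sum_congr rfl fun a _ => Finset.sum_congr rfl fun j _ =>
      Finset.sum_congr rfl fun b _ => ?_
    rw [mul_assoc]
    rfl
  have ht : ∑ a, (p : E3) a * SphereCalculus.divT 𝒮 T a p = 0 := by
    have h3 := congrArg (fun g : Fn => g p) hT.tang_divT
    simp only [coe_sum] at h3
    refine Eq.trans (Finset.sum_congr rfl fun a _ => ?_) h3
    exact mul_comm _ _
  rw [h1, sum_metric_mul, ht, mul_zero, sub_zero]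

/-- The b-terms of (*) symmetrise ⋆∇∇b, whereas `shearPair` rotates the traceless Hessian. They
agree because the rotated traceless Hessian is symmetric, so the antisymmetric part of ⋆∇∇b is half
of ε D²b. -/
lemma shearOf_coe (b c : Fn) :
    shearOf b c = fun p i j => SphereCalculus.shearPair 𝒮 b c i j p := by
  funext p i j
  have hsh : ∀ (f : Fn) (i j : Fin 3), 2 * hess f p i j - metric p i j * lap f p
      = SphereCalculus.shear 𝒮 f i j p := by
    intro f i j
    rw [hess_coe, lap_coe, metric]
    have h2 : ∀ g : Fn, (2 * g) p = 2 * g p := fun g => by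
      rw [two_mul, two_mul]; rfl
    change _ = (2 * (tderiv j (tderiv i f) + coord i * tderiv j f)) p
      - ((if i = j then 1 else 0 : Fn) p - (p : E3) i * (p : E3) j) * SphereCalculus.lap 𝒮 f p
    rw [h2]
    split_ifs <;> rfl
  have hst : ∀ i j, SphereCalculus.starT 𝒮 (SphereCalculus.shear 𝒮 b) i j p
      = ∑ k, eps p i k * (2 * hess b p k j - metric p k j * lap b p) := by
    intro i j
    rw [SphereCalculus.starT, coe_sum]
    simp only [hsh, eps_eq]
    rfl
  have hsymm := congrArg (fun g : Fn => g p)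
    ((SphereCalculus.isSTT_shear 𝒮 b).starT.symm i j)
  simp only [hst] at hsymm
  have hem : ∀ i j, ∑ k, eps p i k * metric p k j = eps p i j := by
    have hx : ∀ k, SphereCalculus.x 𝒮 k p = (p : E3) k := fun _ => rfl
    intro i j
    simp only [eps_eq, metric]
    fin_cases i <;> fin_cases j <;>
      simp [SphereCalculus.E, Fin.sum_univ_three, hx] <;> ring
  have hanti : eps p j i = -eps p i j := by
    have hx : ∀ k, SphereCalculus.x 𝒮 k p = (p : E3) k := fun _ => rfl
    simp only [eps_eq]
    fin_cases i <;> fin_cases j <;> simp [SphereCalculus.E, hx]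
  have hexp : ∀ i j, ∑ k, eps p i k * (2 * hess b p k j - metric p k j * lap b p)
      = 2 * (∑ k, eps p i k * hess b p k j) - eps p i j * lap b p := by
    intro i j
    rw [← hem i j]
    simp only [Fin.sum_univ_three]
    ring
  change shearOf b c p i j = SphereCalculus.shear 𝒮 c i j p
    + SphereCalculus.starT 𝒮 (SphereCalculus.shear 𝒮 b) i j p
  rw [← hsh, hst, shearOf]
  rw [hexp, hexp, hanti] at hsymm
  rw [hexp]
  linarith

lemma quad_coe {T : Fin 3 → Fin 3 → Fn} (hT : SphereCalculus.IsSTT 𝒮 T) (n : Fn) (p : S2) :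
    ∑ i, quad (fun q i j => T i j q) p i * rot n p i = SphereCalculus.quadRot 𝒮 T n p := by
  rw [SphereCalculus.quadRot, coe_sum]
  refine Finset.sum_congr rfl fun i _ => ?_
  have h : quad (fun q i j => T i j q) p i
      = (∑ j, T i j * SphereCalculus.divT 𝒮 T j) p := by
    rw [coe_sum, quad]
    exact Finset.sum_congr rfl fun j _ => by rw [div2_coe hT]; rfl
  rw [h, rot_coe]
  rfl

/-- A smooth function as an element of the algebra of smooth functions. -/
def Smooth.toFn {f : S2 → ℝ} (hf : Smooth f) : Fn := ⟨f, hf⟩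

lemma Smooth.exists_eq_coe {f : S2 → ℝ} (hf : Smooth f) : ∃ g : Fn, f = g := ⟨hf.toFn, rfl⟩

lemma isSTT_of_isSymmTraceless {χ : S2 → Fin 3 → Fin 3 → ℝ} (hχ : IsSymmTraceless χ) :
    SphereCalculus.IsSTT 𝒮 (fun i j => (hχ.smooth i j).toFn) where
  symm i j := ContMDiffMap.ext fun p => hχ.symm p i j
  tang i := ContMDiffMap.ext fun p => by
    rw [coe_sum]
    exact hχ.tangential p i
  trace := ContMDiffMap.ext fun p => by
    rw [coe_sum]
    exact hχ.traceless p

lemma isCWYPotential_coe {T : Fin 3 → Fin 3 → Fn} (hT : SphereCalculus.IsSTT 𝒮 T) (c : Fn) :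
    IsCWYPotential (fun p i j => T i j p) c ↔ c.NoLow ∧
      SphereCalculus.bilap 𝒮 c = SphereCalculus.div 𝒮 (SphereCalculus.divT 𝒮 T) := by
  have h1 : lap (fun q => lap c q + 2 * c q) = SphereCalculus.bilap 𝒮 c := by
    rw [SphereCalculus.bilap, ← lap_coe]
    congr 1
    funext q
    rw [lap_coe, two_mul, two_mul]
    rfl
  have h2 : div1 (div2 fun p i j => T i j p)
      = SphereCalculus.div 𝒮 (SphereCalculus.divT 𝒮 T) := by
    funext p
    rw [← div1_coe]
    congr 1
    funext q i
    exact div2_coe hT q i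
  constructor
  · intro h
    refine ⟨h.noLow, ContMDiffMap.ext fun p => ?_⟩
    rw [← h1, ← h2]
    exact h.eqn p
  · rintro ⟨h, h'⟩
    refine ⟨c.smooth, h, fun p => ?_⟩
    rw [h1, h2, h']

lemma isCWYPotential_unique {T : Fin 3 → Fin 3 → Fn} (hT : SphereCalculus.IsSTT 𝒮 T)
    {c c' : S2 → ℝ} (h : IsCWYPotential (fun p i j => T i j p) c)
    (h' : IsCWYPotential (fun p i j => T i j p) c') : c = c' := by
  obtain ⟨c, rfl⟩ := h.smooth.exists_eq_coe
  obtain ⟨c', rfl⟩ := h'.smooth.exists_eq_coe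
  have e := (isCWYPotential_coe hT c).1 h
  have e' := (isCWYPotential_coe hT c').1 h'
  have := (e.1.sub e'.1).eq_zero_of_bilap (by
    rw [SphereCalculus.bilap_sub, e.2, e'.2, sub_self])
  rw [sub_eq_zero.1 this]

/-! ### The angular momenta -/

lemma areaIntegral_eq {f : Fn} {g : S2 → ℝ} (h : ∀ p, f p = g p) :
    ∫ p, g p ∂area = areaIntegral f :=
  integral_congr_ae (Filter.Eventually.of_forall fun p => (h p).symm)

/-- The pairing of a one-form with the rotation field of `n`. -/
def formRot (N : Fin 3 → Fn) (n : Fn) : Fn :=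
  ∑ i, N i * SphereCalculus.star 𝒮 (SphereCalculus.grad 𝒮 n) i

lemma formRot_apply (N : Fin 3 → Fn) (n : Fn) (p : S2) :
    formRot N n p = ∑ i, N i p * rot n p i := by
  rw [formRot, coe_sum]
  simp only [rot_coe]
  rfl

/-- The density of the quadratic term of the angular momentum in terms of the potentials. -/
def potentialDensity (n b c : Fn) : Fn :=
  SphereCalculus.lap 𝒮 b * (n * SphereCalculus.lap 𝒮 c
    - SphereCalculus.gdot 𝒮 n (SphereCalculus.lap 𝒮 c) - 4 * SphereCalculus.gdot 𝒮 n c)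

lemma potentialDensity_apply (n b c : Fn) (p : S2) :
    potentialDensity n b c p = lap b p * (n p * lap c p - gradDot n (lap c) p
      - 4 * gradDot n c p) := by
  have h4 : ∀ g : Fn, (4 * g) p = 4 * g p := fun g => by
    rw [← map_ofNat (algebraMap ℝ Fn) 4]; rfl
  rw [lap_coe, lap_coe, gradDot_coe, gradDot_coe, ← h4]
  rfl

lemma integral_quad_shearOf (a : Fin 3 → ℝ) (b c : Fn) :
    ∫ p, ∑ i, quad (shearOf b c) p i * rot (SphereCalculus.lin 𝒮 a : Fn) p i ∂area
      = -2 * areaIntegral (potentialDensity (SphereCalculus.lin 𝒮 a) b c) := by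
  rw [shearOf_coe]
  have h := quad_coe (SphereCalculus.isSTT_shearPair 𝒮 b c) (SphereCalculus.lin 𝒮 a)
  rw [areaIntegral_eq fun p => (h p).symm]
  exact SphereCalculus.integral_quadRot 𝒮 a b c

lemma JCJK_eq (a : Fin 3 → ℝ) (N : Fin 3 → Fn) (b c : Fn) :
    JCJK (fun p i => N i p) (shearOf b c) (SphereCalculus.lin 𝒮 a : Fn)
      = 1 / (8 * Real.pi) * (-3 * areaIntegral (formRot N (SphereCalculus.lin 𝒮 a))
        + 1 / 2 * areaIntegral (potentialDensity (SphereCalculus.lin 𝒮 a) b c)) := by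
  set n := SphereCalculus.lin 𝒮 a with hn
  have h := quad_coe (SphereCalculus.isSTT_shearPair 𝒮 b c) n
  have e : ∀ p, ((3 : ℝ) • formRot N n
      + (1 / 4 : ℝ) • SphereCalculus.quadRot 𝒮 (SphereCalculus.shearPair 𝒮 b c) n) p
      = ∑ i, (3 * N i p + 1 / 4 * quad (shearOf b c) p i) * rot n p i := by
    intro p
    rw [shearOf_coe]
    change 3 * formRot N n p + 1 / 4 * SphereCalculus.quadRot 𝒮 _ n p = _
    rw [formRot_apply, ← h]
    simp only [add_mul, Finset.sum_add_distrib, Finset.mul_sum, mul_assoc]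
  have hq : areaIntegral (SphereCalculus.quadRot 𝒮 (SphereCalculus.shearPair 𝒮 b c) n)
      = -2 * areaIntegral (potentialDensity n b c) := SphereCalculus.integral_quadRot 𝒮 a b c
  rw [JCJK, areaIntegral_eq e, map_add, map_smul, map_smul, hq, smul_eq_mul, smul_eq_mul]
  ring

lemma JCN_eq (α : ℝ) (a : Fin 3 → ℝ) (N : Fin 3 → Fn) (b c : Fn) :
    JCN α (fun p i => N i p) (shearOf b c) (SphereCalculus.lin 𝒮 a : Fn)
      = 1 / (8 * Real.pi) * (-3 * areaIntegral (formRot N (SphereCalculus.lin 𝒮 a))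
        + α / 2 * areaIntegral (potentialDensity (SphereCalculus.lin 𝒮 a) b c)) := by
  have h := integral_quad_shearOf a b c
  simp only [mul_comm (quad _ _ _)] at h
  rw [JCN, JCJK_eq, h]
  have := Real.pi_ne_zero
  field_simp
  ring

/-- The value α = 1 serves the Chruściel–Jezierski–Kijowski formula as well. -/
lemma integral_density (α : ℝ) (N : Fin 3 → Fn) (n b c : Fn) :
    ∫ p, (-3 * (∑ i, N i p * rot n p i) - 2 * α * gradDot n c p * lap b p
        + α / 2 * n p * lap b p * lap c p - α / 2 * lap b p * gradDot n (lap c) p) ∂area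
      = -3 * areaIntegral (formRot N n) + α / 2 * areaIntegral (potentialDensity n b c) := by
  rw [areaIntegral_eq (f := (-3 : ℝ) • formRot N n + (α / 2) • potentialDensity n b c), map_add,
    map_smul, map_smul, smul_eq_mul, smul_eq_mul]
  intro p
  change -3 * formRot N n p + α / 2 * potentialDensity n b c p = _
  rw [formRot_apply, potentialDensity_apply]
  ring

end NullInfinity

/-! ### The three assertions for a given shear tensor. -/

theorem mainTheorem9
    (χ : NullInfinity.S2 → Fin 3 → Fin 3 → ℝ) (hχ : NullInfinity.IsSymmTraceless χ)
    (N : NullInfinity.S2 → Fin 3 → ℝ) (hN : NullInfinity.IsOneForm N)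
    (m : NullInfinity.S2 → ℝ) (hm : NullInfinity.Smooth m)
    (n : NullInfinity.S2 → ℝ) (hn : NullInfinity.IsDipole n) (α : ℝ) :
    (∃ b c : NullInfinity.S2 → ℝ,
      NullInfinity.Smooth b ∧ NullInfinity.Smooth c ∧
      NullInfinity.NoLowModes b ∧ NullInfinity.NoLowModes c ∧
      χ = NullInfinity.shearOf b c) ∧
    (∃! c : NullInfinity.S2 → ℝ, NullInfinity.IsCWYPotential χ c) ∧
    (∀ b c : NullInfinity.S2 → ℝ, NullInfinity.Smooth b → NullInfinity.Smooth c →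
      χ = NullInfinity.shearOf b c →
      (∫ p, ∑ i, NullInfinity.quad (NullInfinity.shearOf b 0) p i * NullInfinity.rot n p i
          ∂NullInfinity.area = 0) ∧
      (∫ p, ∑ i, NullInfinity.quad (NullInfinity.shearOf 0 c) p i * NullInfinity.rot n p i
          ∂NullInfinity.area = 0) ∧
      NullInfinity.JCJK N χ n
        = 1 / (8 * Real.pi) * ∫ p,
            (-3 * (∑ i, N p i * NullInfinity.rot n p i)
              - 2 * NullInfinity.gradDot n c p * NullInfinity.lap b p
              + 1 / 2 * n p * NullInfinity.lap b p * NullInfinity.lap c p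
              - 1 / 2 * NullInfinity.lap b p
                  * NullInfinity.gradDot n (NullInfinity.lap c) p) ∂NullInfinity.area ∧
      NullInfinity.JCN α N χ n
        = 1 / (8 * Real.pi) * ∫ p,
            (-3 * (∑ i, N p i * NullInfinity.rot n p i)
              - 2 * α * NullInfinity.gradDot n c p * NullInfinity.lap b p
              + α / 2 * n p * NullInfinity.lap b p * NullInfinity.lap c p
              - α / 2 * NullInfinity.lap b p
                  * NullInfinity.gradDot n (NullInfinity.lap c) p) ∂NullInfinity.area ∧
      (NullInfinity.NoLowModes c →
        NullInfinity.IsCWYPotential χ c ∧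
        NullInfinity.JCWY m N χ n
          = 1 / (8 * Real.pi) * ∫ p,
              (-3 * (∑ i, N p i * NullInfinity.rot n p i)
                - 2 * NullInfinity.gradDot n c p * NullInfinity.lap b p
                + 1 / 2 * n p * NullInfinity.lap b p * NullInfinity.lap c p
                - 1 / 2 * NullInfinity.lap b p
                    * NullInfinity.gradDot n (NullInfinity.lap c) p
                + 2 * m p * ∑ i, NullInfinity.rot n p i * NullInfinity.grad c p i)
              ∂NullInfinity.area)) := by
  open NullInfinity in
  have hT := isSTT_of_isSymmTraceless hχ
  set T : Fin 3 → Fin 3 → Fn := fun i j => (hχ.smooth i j).toFn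
  refine ⟨?_, ?_, ?_⟩
  · obtain ⟨b, c, hb, hc, h⟩ := exists_shearPair_eq hT
    refine ⟨b, c, b.smooth, c.smooth, hb, hc, ?_⟩
    rw [shearOf_coe, ← h]
    rfl
  · obtain ⟨c, hc, h⟩ := exists_noLow_bilap_eq (noLow_div_divT hT)
    have h1 : IsCWYPotential χ c := (isCWYPotential_coe hT c).2 ⟨hc, h⟩
    exact ⟨c, h1, fun c' h' => isCWYPotential_unique hT h' h1⟩
  · intro b c hb hc hbc
    obtain ⟨a, ha⟩ := hn
    obtain rfl : n = (sphereCalculus.lin (fun i => a i) : Fn) := by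
      funext p
      rw [ha, coe_lin]
      simp [PiLp.inner_apply, mul_comm]
    obtain ⟨b, rfl⟩ := hb.exists_eq_coe
    obtain ⟨c, rfl⟩ := hc.exists_eq_coe
    obtain ⟨m, rfl⟩ := hm.exists_eq_coe
    obtain ⟨N, rfl⟩ : ∃ N' : Fin 3 → Fn, N = fun p i => N' i p :=
      ⟨fun i => (hN.smooth i).toFn, rfl⟩
    set n := sphereCalculus.lin (fun i => a i) with hndef
    have hlap0 : sphereCalculus.lap 0 = 0 := by simp [SphereCalculus.lap]
    have e1 := integral_density 1 N n b c
    simp only [mul_one] at e1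
    have hJ : JCJK (fun p i => N i p) χ n = 1 / (8 * Real.pi) *
        (-3 * areaIntegral (formRot N n) + 1 / 2 * areaIntegral (potentialDensity n b c)) := by
      rw [hbc]
      exact JCJK_eq _ N b c
    refine ⟨?_, ?_, ?_, ?_, ?_⟩
    · have h := integral_quad_shearOf (fun i => a i) b 0
      refine h.trans ?_
      simp [potentialDensity, hlap0, SphereCalculus.gdot]
    · have h := integral_quad_shearOf (fun i => a i) 0 c
      refine h.trans ?_
      simp [potentialDensity, hlap0]
    · rw [hJ, e1]
    · rw [integral_density, hbc]
      exact JCN_eq α _ N b c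
    · intro hlow
      have hTS : T = sphereCalculus.shearPair b c := by
        funext i j
        refine ContMDiffMap.ext fun p => ?_
        have := congrFun (congrFun (congrFun hbc p) i) j
        rw [shearOf_coe] at this
        exact this
      have hpot : IsCWYPotential χ c := by
        refine (isCWYPotential_coe hT c).2 ⟨hlow, ?_⟩
        rw [hTS, SphereCalculus.div_divT_shearPair]
        rfl
      -- The choice operator returns some potential because c is one, and uniqueness identifies the
      -- two.
      have hcwy : cwyPotential χ = c :=
        isCWYPotential_unique hT (Classical.epsilon_spec ⟨_, hpot⟩) hpot
      refine ⟨hpot, ?_⟩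
      have em : ∀ p, (m * formRot (sphereCalculus.grad c) n) p
          = m p * ∑ i, rot n p i * grad c p i := by
        intro p
        change m p * formRot (sphereCalculus.grad c) n p = _
        rw [formRot_apply]
        simp only [mul_comm (rot _ _ _)]
        rfl
      have et : ∀ p, ((-3 : ℝ) • formRot N n + (1 / 2 : ℝ) • potentialDensity n b c
            + (2 : ℝ) • (m * formRot (sphereCalculus.grad c) n)) p
          = -3 * (∑ i, N i p * rot n p i) - 2 * gradDot n c p * lap b p
            + 1 / 2 * n p * lap b p * lap c p - 1 / 2 * lap b p * gradDot n (lap c) p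
            + 2 * m p * ∑ i, rot n p i * grad c p i := by
        intro p
        change -3 * formRot N n p + 1 / 2 * potentialDensity n b c p
          + 2 * (m * formRot (sphereCalculus.grad c) n) p = _
        rw [em, formRot_apply, potentialDensity_apply]
        ring
      rw [areaIntegral_eq et, JCWY, hJ, hcwy, areaIntegral_eq em, map_add, map_add, map_smul,
        map_smul, map_smul]
      simp only [smul_eq_mul]
      have := Real.pi_ne_zero
      field_simp
      ring

end
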